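/- **Theorem 3.5.** For $\bar x\in\mathbb R^2$ and $r>0$ let $Q(\bar x,r)=\{x\in\mathbb R^2: |x_i-\bar x_i|<r,\ i=1,2\}$, and let $Q=Q(\bar x,r)$. Let $g\in C(\overline Q,\mathbb R^2)\cap BV(Q,\mathbb R^2)$, that is, $g$ is continuous on $\overline Q$, integrable on $Q$, and its distributional derivative $Dg$ on $Q$ is a finite $\mathbb R^{2\times 2}$-valued measure; $|Dg|$ denotes its total variation measure (with respect to the Euclidean norm on $\mathbb R^{2\times2}$). Suppose that the image $g(\partial Q)$ has Lebesgue measure zero and that $$\sup_{0<\rho<r}\frac{|Dg|\bigl(Q\setminus Q(\bar x,\rho)\bigr)}{r-\rho}<\infty .$$ Let $\deg(g,Q,y)$, $y\in\mathbb R^2\setminus g(\partial Q)$, be the topological (Brouwer) degree. Then $\deg(g,Q,\cdot)$ is integrable over $\mathbb R^2$, the distributional Jacobian $$\operatorname{Det}Dg=\lim_{\varepsilon\to0+}\det\nabla g_\varepsilon\quad\text{in }\mathcal D'(Q),$$ where $g_\varepsilon$ are the standard mollifications of $g$, exists and does not depend on the mollification kernel (nonnegative, smooth, supported in the closed unit ball,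 with integral $1$), and $$\int_{\mathbb R^2}\deg(g,Q,y)\,dy=\operatorname{Det}Dg(Q).$$ Here, if the distribution $\operatorname{Det}Dg$ is a finite signed measure on $Q$, then $\operatorname{Det}Dg(Q)$ is the value of this measure on $Q$. In every case, whether or not $\operatorname{Det}Dg$ is a measure, the formula also holds in the sense that $$\lim_{k\to\infty}\langle\operatorname{Det}Dg,\varphi_k\rangle=\int_{\mathbb R^2}\deg(g,Q,y)\,dy$$ for all $C<\infty$, all $\rho_k\in(0,r)$ with $\rho_k\to r$, and all smooth functions $\varphi_k$ with compact support in $Q$ such that $\varphi_k=1$ on $Q(\bar x,\rho_k)$ and $|\nabla\varphi_k|\le C/(r-\rho_k)$. -/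

import Mathlib

open Set Filter Topology MeasureTheory TopologicalSpace
open scoped ContDiff Distributions

/-- The Euclidean plane. -/
abbrev Plane : Type := EuclideanSpace ℝ (Fin 2)

/-- Real `2 × 2` matrices as a Euclidean space, that is, with the Frobenius norm.
The entry `(j, i)` is the one in row `j` and column `i`. -/
abbrev PlaneMatrix : Type := EuclideanSpace ℝ (Fin 2 × Fin 2)

/-- The open square with center `c`, half side length `r` and sides parallel to the axes. -/
def square (c : Plane) (r : ℝ) : Opens Plane where
  carrier := {x | ∀ i, |x i - c i| < r}
  is_open' := by
    simp only [Set.ofPred_forall]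
    exact isOpen_iInter_of_finite fun i => isOpen_lt (by fun_prop) continuous_const

/-! ### Maps of bounded variation -/

/-- The matrix-valued measure `Dg` is the distributional derivative of `g` on `Ω`: its entry
`(j, i)` is the distributional partial derivative `D_i g_j`. Only the restriction of `Dg` to
`Ω` is relevant (and is determined by `g`). -/
def IsDistribDeriv (Ω : Opens Plane) (g : Plane → Plane) (Dg : VectorMeasure Plane PlaneMatrix) :
    Prop :=
  ∀ (φ : 𝓓(Ω, ℝ)) (i j : Fin 2),
    ∫ x in (Ω : Set Plane), g x j * fderiv ℝ φ x (EuclideanSpace.single i 1)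
      = - (∫ᵛ x in (Ω : Set Plane), φ x ∂•Dg) (j, i)

/-- `g` belongs to `BV(Ω, ℝ²)` with distributional derivative `Dg`: it is integrable on `Ω`, and
its distributional derivative on `Ω` is the finite matrix-valued measure `Dg`. -/
structure IsBVWith (Ω : Opens Plane) (g : Plane → Plane)
    (Dg : VectorMeasure Plane PlaneMatrix) : Prop where
  integrableOn : IntegrableOn g (Ω : Set Plane) volume
  isDistribDeriv : IsDistribDeriv Ω g Dg

/-! ### Topological degree -/

section Degree

variable {E : Type*} [NormedAddCommGroup E] [NormedSpace ℝ E]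

/-- The map `h` is smooth, its distance from `f` on the closure of `Ω` is everywhere less than
the distance from `y` to `f (∂Ω)`, and `y` is a regular value of `h` on `Ω`. -/
structure IsRegularApprox (f : E → E) (Ω : Set E) (y : E) (h : E → E) : Prop where
  contDiff : ContDiff ℝ ∞ h
  close : ∃ δ : ℝ, (∀ z ∈ frontier Ω, δ ≤ dist (f z) y) ∧ ∀ x ∈ closure Ω, dist (h x) (f x) < δ
  regular : ∀ x ∈ Ω, h x = y → (fderiv ℝ h x).det ≠ 0

/-- The sum of the signs of the Jacobian of `h` over the preimages of `y` in `Ω`. -/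
noncomputable def signSum (h : E → E) (Ω : Set E) (y : E) : ℤ :=
  ∑ᶠ x ∈ {x | x ∈ Ω ∧ h x = y}, ((SignType.sign (fderiv ℝ h x).det : SignType) : ℤ)

/-- `d` is the degree of `f` on `Ω` at `y`: the common value of the sign sums at `y` of all smooth
maps sufficiently close to `f` for which `y` is a regular value. -/
def IsDegree (f : E → E) (Ω : Set E) (y : E) (d : ℤ) : Prop :=
  (∃ h, IsRegularApprox f Ω y h) ∧ ∀ h, IsRegularApprox f Ω y h → signSum h Ω y = d

open Classical in
/-- The topological (Brouwer) degree `deg(f, Ω, y)` of a map `f` that is continuous on the closure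
of the bounded open set `Ω`, at a point `y ∉ f (∂Ω)`. For `y ∈ f (∂Ω)` the value is `0`. -/
noncomputable def topDegree (f : E → E) (Ω : Set E) (y : E) : ℤ :=
  if H : ∃ d, IsDegree f Ω y d then H.choose else 0

end Degree

/-! ### The distributional Jacobian -/

/-- `η` is a mollification kernel on the plane. -/
structure IsMollifier (η : Plane → ℝ) : Prop where
  contDiff : ContDiff ℝ ∞ η
  nonneg : ∀ x, 0 ≤ η x
  support_subset : Function.support η ⊆ Metric.closedBall 0 1
  integral_eq_one : ∫ x, η x = 1

/-- The mollification of `g` with kernel `η` at scale `ε`. At points of `Ω` whose distance from the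
boundary is greater than `ε` it is the average of `g` with weight `ε⁻² η((x - ·) / ε)`. -/
noncomputable def mollify (η : Plane → ℝ) (ε : ℝ) (Ω : Opens Plane) (g : Plane → Plane)
    (x : Plane) : Plane :=
  ∫ z in (Ω : Set Plane), ((ε ^ 2)⁻¹ * η (ε⁻¹ • (x - z))) • g z

/-- The distribution `J` is the distributional Jacobian `Det Dg` of `g` on `Ω`: the limit, in the
sense of distributions, of the Jacobians of the mollifications of `g`. -/
def IsDistribJacobian (Ω : Opens Plane) (g : Plane → Plane) (J : 𝓓'(Ω, ℝ)) : Prop :=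
  ∀ η, IsMollifier η → ∀ φ : 𝓓(Ω, ℝ),
    Tendsto (fun ε : ℝ => ∫ x in (Ω : Set Plane), φ x * (fderiv ℝ (mollify η ε Ω g) x).det)
      (𝓝[>] 0) (𝓝 (J φ))

/-- The distribution `J` on `Ω` is the finite signed measure `μ`. -/
def IsRepresentedBy (Ω : Opens Plane) (J : 𝓓'(Ω, ℝ)) (μ : SignedMeasure Plane) : Prop :=
  ∀ φ : 𝓓(Ω, ℝ), J φ = ∫ᵛ x in (Ω : Set Plane), φ x ∂•μ

/-- The distribution `J` on the square has total mass `m`, obtained as the limit of its values on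
cut-off functions: `J φₖ → m` whenever `φₖ` is a test function on the square that equals `1` on
the concentric square of half side `ρₖ`, with `|∇φₖ| ≤ C / (r - ρₖ)`, and `ρₖ → r`. -/
def HasCutoffMass (c : Plane) (r : ℝ) (J : 𝓓'(square c r, ℝ)) (m : ℝ) : Prop :=
  ∀ (C : ℝ) (ρ : ℕ → ℝ) (φ : ℕ → 𝓓(square c r, ℝ)),
    (∀ k, ρ k ∈ Ioo 0 r) → Tendsto ρ atTop (𝓝 r) →
    (∀ k, ∀ x ∈ square c (ρ k), φ k x = 1) →
    (∀ k x, ‖fderiv ℝ (φ k) x‖ ≤ C / (r - ρ k)) →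
    Tendsto (fun k => J (φ k)) atTop (𝓝 m)

/-!
The degree of `g` is obtained as the limit of smoothed push-forwards of its Jacobian. Let `g_ε` be a
mollification of (an extension of) `g`, let `φ` be a cut-off function of the square and let `K_δ` be
a mollification kernel of radius `δ`. The function
`u y = ∫ φ x * K_δ (g_ε x - y) * det ∇g_ε x dx` (`pushforwardDensity`) has the following properties.

* Its integral is `∫ φ det ∇g_ε` (`integral_pushforwardDensity`), which tends to `⟨Det Dg, φ⟩` as
  `ε → 0`. The limit exists because `det ∇g_ε dx = d(g_ε₀) ∧ d(g_ε₁)`, so that the integral equals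
  `-∫ g_ε₀ dφ ∧ d(g_ε₁)`, and here `g_ε₀` converges uniformly while `d(g_ε₁)` converges to the
  measure `Dg₁` and is bounded in `L¹` (`isDistribJacobian_tendsto`).
* At a point `y` off `g (∂Q)` it is equal to `deg(g, Q, y)` as soon as `φ = 1` on a large part of the
  square and `ε`, `δ` are small (`pushforwardDensity_eq_topDegree`). This is the integral formula for
  the degree: `∫ K_δ (h x - y) det ∇h x dx` is invariant under homotopies that keep the image of the
  boundary away from `y`, does not depend on `δ`, and counts preimages with sign when `y` is a
  regular value of `h` (`kernelDegree_eq_topDegree`). Smooth approximations with `y` as a regular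
  value exist by Sard's lemma.
* By Stokes' formula each partial derivative of `u` is, up to sign, the smoothed push-forward of
  `dφ ∧ d(g_ε)_j`; hence `‖∇u‖_{L¹} ≤ ∑ ∫ |dφ ∧ d(g_ε)_j|`. The gradient of `φ` is at most
  `C / (r - ρ)` and vanishes on the square of half side `ρ`, and on the rest of `Q` the variation of
  `g_ε` is at most a constant times `r - ρ` by the assumption on `|Dg|`. So the
  Gagliardo–Nirenberg–Sobolev inequality bounds `u` in `L²`, uniformly along the sequence of cut-off
  functions (`eLpNorm_pushforwardDensity_le`, `lintegral_bracket_mollify_le`).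

As `g (∂Q)` is a null set, the functions `u` converge almost everywhere to the degree; being bounded
in `L²` and supported in a fixed disc, they converge in `L¹` by Vitali's theorem. Hence the degree is
integrable, and its integral is the limit of `⟨Det Dg, φₖ⟩` (`integrable_topDegree_and_tendsto`). If
the distributional Jacobian is a measure, that limit is the mass of the square by dominated
convergence.
-/

/-! ### Jacobian brackets and Stokes' formula in the plane -/

/-- The partial derivative `∂ᵢ u` of a real function on the plane. -/
noncomputable def pderiv (i : Fin 2) (u : Plane → ℝ) (x : Plane) : ℝ :=
  fderiv ℝ u x (EuclideanSpace.single i 1)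

/-- The Jacobian `∂₀u ∂₁v - ∂₁u ∂₀v` of the pair `(u, v)`: the density of `du ∧ dv`. -/
noncomputable def bracket (u v : Plane → ℝ) (x : Plane) : ℝ :=
  pderiv 0 u x * pderiv 1 v x - pderiv 1 u x * pderiv 0 v x

theorem contDiff_coord {h : Plane → Plane} {n : WithTop ℕ∞} (hh : ContDiff ℝ n h) (j : Fin 2) :
    ContDiff ℝ n fun x => h x j := by fun_prop

theorem ContDiff.pderiv {u : Plane → ℝ} {m n : WithTop ℕ∞} (hu : ContDiff ℝ n u)
    (hmn : m + 1 ≤ n) (i : Fin 2) : ContDiff ℝ m (pderiv i u) :=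
  (hu.fderiv_right hmn).clm_apply contDiff_const

theorem ContDiff.pderiv_infty {u : Plane → ℝ} (hu : ContDiff ℝ ∞ u) (i : Fin 2) :
    ContDiff ℝ ∞ (_root_.pderiv i u) := hu.pderiv (by simp) i

theorem ContDiff.continuous_pderiv {u : Plane → ℝ} {n : WithTop ℕ∞} (hu : ContDiff ℝ n u)
    (hn : n ≠ 0) (i : Fin 2) : Continuous (_root_.pderiv i u) :=
  ((hu.of_le (ENat.one_le_iff_ne_zero_withTop.2 hn)).pderiv (m := 0) (by simp) i).continuous

theorem continuous_bracket {u v : Plane → ℝ} {m n : WithTop ℕ∞} (hu : ContDiff ℝ m u)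
    (hv : ContDiff ℝ n v) (hm : m ≠ 0) (hn : n ≠ 0) : Continuous (bracket u v) :=
  ((hu.continuous_pderiv hm 0).mul (hv.continuous_pderiv hn 1)).sub
    ((hu.continuous_pderiv hm 1).mul (hv.continuous_pderiv hn 0))

theorem HasCompactSupport.pderiv {u : Plane → ℝ} (hu : HasCompactSupport u) (i : Fin 2) :
    HasCompactSupport (_root_.pderiv i u) :=
  hu.fderiv_apply (𝕜 := ℝ) (v := EuclideanSpace.single i (1 : ℝ))

theorem tsupport_pderiv_subset (u : Plane → ℝ) (i : Fin 2) : tsupport (pderiv i u) ⊆ tsupport u :=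
  tsupport_fderiv_apply_subset ℝ (EuclideanSpace.single i (1 : ℝ))

theorem pderiv_mul {u v : Plane → ℝ} {x : Plane} (hu : DifferentiableAt ℝ u x)
    (hv : DifferentiableAt ℝ v x) (i : Fin 2) :
    pderiv i (fun x => u x * v x) x = u x * pderiv i v x + pderiv i u x * v x := by
  unfold pderiv
  rw [fderiv_fun_mul hu hv]
  simp [mul_comm]

theorem pderiv_comm {v : Plane → ℝ} (hv : ContDiff ℝ 2 v) (x : Plane) :
    pderiv 0 (pderiv 1 v) x = pderiv 1 (pderiv 0 v) x := by
  have hd : DifferentiableAt ℝ (fderiv ℝ v) x :=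
    (hv.fderiv_right (m := 1) (by norm_num)).differentiable (by norm_num) x
  have hs := (hv.contDiffAt (x := x)).isSymmSndFDerivAt (by simp)
  unfold pderiv
  rw [fderiv_clm_apply hd (differentiableAt_const _), fderiv_clm_apply hd (differentiableAt_const _)]
  simpa using hs.eq _ _

theorem pderiv_congr {u v : Plane → ℝ} {x : Plane} (h : u =ᶠ[𝓝 x] v) (i : Fin 2) :
    pderiv i u x = pderiv i v x := by
  unfold pderiv; rw [h.fderiv_eq]

theorem bracket_congr {u u' v v' : Plane → ℝ} {x : Plane} (hu : u =ᶠ[𝓝 x] u')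
    (hv : v =ᶠ[𝓝 x] v') : bracket u v x = bracket u' v' x := by
  simp only [bracket, pderiv_congr hu, pderiv_congr hv]

theorem bracket_swap (u v : Plane → ℝ) (x : Plane) : bracket v u x = -bracket u v x := by
  unfold bracket; ring

theorem pderiv_coord {h : Plane → Plane} {x : Plane} (hh : DifferentiableAt ℝ h x) (i j : Fin 2) :
    pderiv i (fun x => h x j) x = (fderiv ℝ h x (EuclideanSpace.single i 1)) j := by
  have := ((EuclideanSpace.proj (𝕜 := ℝ) j).hasFDerivAt.comp x hh.hasFDerivAt).fderiv
  have h2 : (fun x => h x j) = (EuclideanSpace.proj (𝕜 := ℝ) j : Plane → ℝ) ∘ h := rfl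
  rw [pderiv, h2, this]; rfl

theorem det_eq_bracket {h : Plane → Plane} {x : Plane} (hh : DifferentiableAt ℝ h x) :
    (fderiv ℝ h x).det = bracket (fun x => h x 0) (fun x => h x 1) x := by
  rw [ContinuousLinearMap.det, ← LinearMap.det_toMatrix (EuclideanSpace.basisFun (Fin 2) ℝ).toBasis,
    Matrix.det_fin_two]
  simp only [LinearMap.toMatrix_apply, bracket, pderiv_coord hh]
  simp

theorem integral_pderiv_eq_zero {u : Plane → ℝ} (hu : ContDiff ℝ 1 u) (hc : HasCompactSupport u)
    (i : Fin 2) : ∫ x, pderiv i u x = 0 := by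
  have h1 := (hu.continuous_pderiv one_ne_zero i).integrable_of_hasCompactSupport (hc.pderiv i)
    (μ := volume)
  have h0 := hu.continuous.integrable_of_hasCompactSupport hc (μ := volume)
  have := integral_mul_fderiv_eq_neg_fderiv_mul_of_integrable (μ := (volume : Measure Plane))
    (f := fun _ => (1 : ℝ)) (g := u) (v := EuclideanSpace.single i 1) (by simp)
    (by simpa using! h1) (by simpa using h0) (by fun_prop)
    (fun x _ => hu.differentiable one_ne_zero x)
  simpa using! this

theorem bracket_eq_div {u v : Plane → ℝ} (hu : ContDiff ℝ 1 u) (hv : ContDiff ℝ 2 v)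
    (x : Plane) : bracket u v x
      = pderiv 0 (fun x => u x * pderiv 1 v x) x - pderiv 1 (fun x => u x * pderiv 0 v x) x := by
  have hd (i) : DifferentiableAt ℝ (pderiv i v) x :=
    (hv.pderiv (m := 1) (by norm_num) i).differentiable one_ne_zero x
  have hu' := hu.differentiable one_ne_zero x
  rw [pderiv_mul hu' (hd 1), pderiv_mul hu' (hd 0), pderiv_comm hv, bracket]
  ring

theorem integral_bracket_eq_zero {u v : Plane → ℝ} (hu : ContDiff ℝ 1 u) (hv : ContDiff ℝ 2 v)
    (hc : HasCompactSupport u) : ∫ x, bracket u v x = 0 := by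
  have hC (i) : ContDiff ℝ 1 (fun x => u x * pderiv i v x) :=
    hu.mul (hv.pderiv (m := 1) (by norm_num) i)
  have hS (i) : HasCompactSupport (fun x => u x * pderiv i v x) := hc.mul_right
  simp_rw [bracket_eq_div hu hv]
  rw [integral_sub, integral_pderiv_eq_zero (hC 1) (hS 1), integral_pderiv_eq_zero (hC 0) (hS 0),
    sub_zero]
  · exact ((hC 1).continuous_pderiv one_ne_zero 0).integrable_of_hasCompactSupport ((hS 1).pderiv 0)
  · exact ((hC 0).continuous_pderiv one_ne_zero 1).integrable_of_hasCompactSupport ((hS 0).pderiv 1)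

theorem bracket_mul_left {u v φ : Plane → ℝ} {x : Plane} (hφ : DifferentiableAt ℝ φ x)
    (hu : DifferentiableAt ℝ u x) :
    bracket (fun x => φ x * u x) v x = φ x * bracket u v x + u x * bracket φ v x := by
  simp only [bracket, pderiv_mul hφ hu]
  ring

theorem hasCompactSupport_bracket {u : Plane → ℝ} (hc : HasCompactSupport u) (v : Plane → ℝ) :
    HasCompactSupport (bracket u v) :=
  ((hc.pderiv 0).mul_right).sub ((hc.pderiv 1).mul_right)

/-- Integration by parts for the Jacobian bracket: `∫ φ du ∧ dv = - ∫ u dφ ∧ dv`. -/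
theorem integral_mul_bracket {u v φ : Plane → ℝ} (hφ : ContDiff ℝ 1 φ) (hc : HasCompactSupport φ)
    (hu : ContDiff ℝ 1 u) (hv : ContDiff ℝ 2 v) :
    ∫ x, φ x * bracket u v x = -∫ x, u x * bracket φ v x := by
  have h := integral_bracket_eq_zero (hφ.mul hu) hv hc.mul_right
  have hb : Continuous (bracket u v) := continuous_bracket hu hv (by simp) (by simp)
  have hb' : Continuous (bracket φ v) := continuous_bracket hφ hv (by simp) (by simp)
  have hcb : HasCompactSupport (bracket φ v) := hasCompactSupport_bracket hc v
  have he (x : Plane) : bracket (fun x => φ x * u x) v x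
      = φ x * bracket u v x + u x * bracket φ v x :=
    bracket_mul_left (hφ.differentiable one_ne_zero x) (hu.differentiable one_ne_zero x)
  simp_rw [he] at h
  rw [integral_add] at h
  · linarith
  · exact (hφ.continuous.mul hb).integrable_of_hasCompactSupport hc.mul_right
  · exact (hu.continuous.mul hb').integrable_of_hasCompactSupport hcb.mul_left

theorem clm_plane_apply (L : Plane →L[ℝ] ℝ) (v : Plane) :
    L v = L (EuclideanSpace.single 0 1) * v 0 + L (EuclideanSpace.single 1 1) * v 1 := by
  have : v = v 0 • EuclideanSpace.single 0 (1 : ℝ) + v 1 • EuclideanSpace.single 1 (1 : ℝ) := by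
    ext i; fin_cases i <;> simp
  conv_lhs => rw [this]
  simp [mul_comm]

theorem pderiv_comp {W : Plane → ℝ} {h : Plane → Plane} {x : Plane}
    (hW : DifferentiableAt ℝ W (h x)) (hh : DifferentiableAt ℝ h x) (i : Fin 2) :
    pderiv i (fun x => W (h x)) x = pderiv 0 W (h x) * pderiv i (fun x => h x 0) x
      + pderiv 1 W (h x) * pderiv i (fun x => h x 1) x := by
  have h1 := (hW.hasFDerivAt.comp x hh.hasFDerivAt).fderiv
  rw [pderiv_coord hh, pderiv_coord hh, pderiv, show (fun x => W (h x)) = W ∘ h from rfl, h1]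
  exact clm_plane_apply (fderiv ℝ W (h x)) _

theorem bracket_comp_left {W : Plane → ℝ} {h : Plane → Plane} {x : Plane}
    (hW : DifferentiableAt ℝ W (h x)) (hh : DifferentiableAt ℝ h x) :
    bracket (fun x => W (h x)) (fun x => h x 1) x
      = pderiv 0 W (h x) * bracket (fun x => h x 0) (fun x => h x 1) x := by
  simp only [bracket, pderiv_comp hW hh]; ring

theorem bracket_comp_right {W : Plane → ℝ} {h : Plane → Plane} {x : Plane}
    (hW : DifferentiableAt ℝ W (h x)) (hh : DifferentiableAt ℝ h x) :
    bracket (fun x => W (h x)) (fun x => h x 0) x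
      = -(pderiv 1 W (h x) * bracket (fun x => h x 0) (fun x => h x 1) x) := by
  simp only [bracket, pderiv_comp hW hh]; ring

/-- Stokes' formula for the pull-back under `h` of the exact form `d(W dy₁)`. -/
theorem integral_mul_pderiv_zero_comp {W φ : Plane → ℝ} {h : Plane → Plane} (hW : ContDiff ℝ 1 W)
    (hh : ContDiff ℝ ∞ h) (hφ : ContDiff ℝ 1 φ) (hc : HasCompactSupport φ) :
    ∫ x, φ x * (pderiv 0 W (h x) * (fderiv ℝ h x).det)
      = -∫ x, W (h x) * bracket φ (fun x => h x 1) x := by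
  have hWh : ContDiff ℝ 1 fun x => W (h x) := hW.comp (contDiff_infty.1 hh 1)
  rw [← integral_mul_bracket hφ hc hWh (contDiff_infty.1 (contDiff_coord hh 1) 2)]
  congr with x
  have hd := hh.differentiable (by simp) x
  rw [det_eq_bracket hd, ← bracket_comp_left (hW.differentiable one_ne_zero _) hd]

/-- Stokes' formula for the pull-back under `h` of the exact form `d(W dy₀)`. -/
theorem integral_mul_pderiv_one_comp {W φ : Plane → ℝ} {h : Plane → Plane} (hW : ContDiff ℝ 1 W)
    (hh : ContDiff ℝ ∞ h) (hφ : ContDiff ℝ 1 φ) (hc : HasCompactSupport φ) :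
    ∫ x, φ x * (pderiv 1 W (h x) * (fderiv ℝ h x).det)
      = ∫ x, W (h x) * bracket φ (fun x => h x 0) x := by
  have hWh : ContDiff ℝ 1 fun x => W (h x) := hW.comp (contDiff_infty.1 hh 1)
  have := integral_mul_bracket hφ hc hWh (contDiff_infty.1 (contDiff_coord hh 0) 2)
  rw [← neg_eq_iff_eq_neg, ← integral_neg] at this
  refine Eq.trans ?_ this
  congr with x
  have hd := hh.differentiable (by simp) x
  rw [det_eq_bracket hd]
  rw [bracket_comp_right (hW.differentiable one_ne_zero _) hd]
  ring

/-! ### Homotopy invariance of the integrals `∫ w(h) det ∇h` -/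

/-- A smooth compactly supported function is a derivative `∂₀ W` (with `W` in general not compactly
supported): `W` is its convolution with the one-dimensional measure on a half-line. -/
theorem exists_pderiv_zero_eq {w : Plane → ℝ} (hw : ContDiff ℝ ∞ w) (hc : HasCompactSupport w) :
    ∃ W : Plane → ℝ, ContDiff ℝ ∞ W ∧ ∀ y, pderiv 0 W y = w y := by
  set e : Plane := EuclideanSpace.single 0 1 with he
  set μ : Measure Plane := (volume.restrict (Ioi (0 : ℝ))).map (fun s => s • e) with hμ
  have hmeas : Measurable (fun s : ℝ => s • e) := by fun_prop
  have : IsLocallyFiniteMeasure μ := by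
    refine ⟨fun x => ⟨Metric.ball x 1, Metric.ball_mem_nhds _ one_pos, ?_⟩⟩
    rw [hμ, Measure.map_apply hmeas Metric.isOpen_ball.measurableSet]
    refine (Measure.restrict_le_self _).trans_lt ?_
    refine (measure_mono (t := Metric.ball (x 0) 1) fun s hs => ?_).trans_lt measure_ball_lt_top
    have h1 := (PiLp.norm_apply_le (s • e - x) 0).trans_lt (by simpa [dist_eq_norm] using hs)
    simpa [he, dist_eq_norm] using h1
  have hli : LocallyIntegrable (fun _ : Plane => (1 : ℝ)) μ := locallyIntegrable_const _
  refine ⟨convolution (fun _ => (1 : ℝ)) w (ContinuousLinearMap.lsmul ℝ ℝ) μ,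
    hc.contDiff_convolution_right _ hli hw, fun y => ?_⟩
  have hw1 : ContDiff ℝ 1 w := contDiff_infty.1 hw 1
  have hfc : HasCompactSupport (fderiv ℝ w) := hc.fderiv (𝕜 := ℝ)
  have hint : Integrable (fun t : Plane => fderiv ℝ w (y - t)) μ := by
    have hcs : HasCompactSupport (fun t : Plane => fderiv ℝ w (y - t)) :=
      hfc.comp_homeomorph (Homeomorph.subLeft y)
    exact Continuous.integrable_of_hasCompactSupport
      ((hw1.continuous_fderiv one_ne_zero).comp (by fun_prop)) hcs
  have hfd : HasFDerivAt (convolution (fun _ => (1 : ℝ)) w (ContinuousLinearMap.lsmul ℝ ℝ) μ)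
      (∫ t, fderiv ℝ w (y - t) ∂μ) y := by
    -- the derivative of a convolution with a measure which is not translation invariant, as a
    -- convolution depending trivially on a parameter
    have h0 := hasFDerivAt_convolution_right_with_param (P := ℝ) (ContinuousLinearMap.lsmul ℝ ℝ)
      (g := fun _ => w) (s := univ) isOpen_univ hc.isCompact
      (fun _ x _ hx => image_eq_zero_of_notMem_tsupport hx) hli
      (hw1.comp contDiff_snd).contDiffOn ((0 : ℝ), y) (mem_univ _)
    have h1 := h0.comp y (hasFDerivAt_prodMk_right (𝕜 := ℝ) (0 : ℝ) y)
    refine h1.congr_fderiv ?_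
    have hF (t : Plane) : (ContinuousLinearMap.precompR (ℝ × Plane)
        (ContinuousLinearMap.lsmul ℝ ℝ) (1 : ℝ))
          (fderiv ℝ (Function.uncurry fun _ : ℝ => w) ((0 : ℝ), y - t))
        = (ContinuousLinearMap.compL ℝ (ℝ × Plane) Plane ℝ).flip
            (ContinuousLinearMap.snd ℝ ℝ Plane) (fderiv ℝ w (y - t)) := by
      have := (HasFDerivAt.comp (f := (Prod.snd : ℝ × Plane → Plane)) ((0 : ℝ), y - t)
        (hw1.differentiable one_ne_zero (y - t)).hasFDerivAt hasFDerivAt_snd).fderiv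
      rw [show (Function.uncurry fun _ : ℝ => w) = w ∘ Prod.snd from rfl, this]
      ext v <;> simp
    change (∫ t, (ContinuousLinearMap.precompR (ℝ × Plane)
        (ContinuousLinearMap.lsmul ℝ ℝ) (1 : ℝ))
          (fderiv ℝ (Function.uncurry fun _ : ℝ => w) ((0 : ℝ), y - t)) ∂μ).comp _ = _
    simp_rw [hF]
    rw [ContinuousLinearMap.integral_comp_comm _ hint]
    ext v
    simp
  rw [pderiv, hfd.fderiv, ContinuousLinearMap.integral_apply hint, hμ,
    integral_map hmeas.aemeasurable]
  · have hd (s : ℝ) : HasDerivAt (fun s : ℝ => -w (y - s • e)) (fderiv ℝ w (y - s • e) e) s := by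
      have hg : HasDerivAt (fun s : ℝ => y - s • e) (-e) s := by
        simpa using! ((hasDerivAt_id s).smul_const e).const_sub y
      have := (hw1.differentiable one_ne_zero (y - s • e)).hasFDerivAt.comp_hasDerivAt s hg
      simpa using! this.neg
    have hemb : Topology.IsClosedEmbedding (fun s : ℝ => y - s • e) := by
      have h1 : Topology.IsClosedEmbedding (fun s : ℝ => s • e) :=
        isClosedEmbedding_smul_left (by simp [he])
      exact (Homeomorph.subLeft y).isClosedEmbedding.comp h1
    have hcs : HasCompactSupport (fun s : ℝ => -w (y - s • e)) :=
      (hc.comp_isClosedEmbedding hemb).neg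
    have hcs' : HasCompactSupport (fun s : ℝ => fderiv ℝ w (y - s • e) e) :=
      (hc.fderiv_apply (𝕜 := ℝ) (v := e)).comp_isClosedEmbedding hemb
    have hcont : Continuous (fun s : ℝ => fderiv ℝ w (y - s • e) e) :=
      ((hw1.continuous_fderiv one_ne_zero).comp
        (by fun_prop : Continuous fun s : ℝ => y - s • e)).clm_apply continuous_const
    have hlim : Tendsto (fun s : ℝ => -w (y - s • e)) atTop (𝓝 0) :=
      hcs.is_zero_at_infty.mono_left (by rw [cocompact_eq_atBot_atTop]; exact le_sup_right)
    rw [integral_Ioi_of_hasDerivAt_of_tendsto' (fun s _ => hd s)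
      (hcont.integrable_of_hasCompactSupport hcs').integrableOn hlim]
    simp
  · exact (((hw1.continuous_fderiv one_ne_zero).comp
      (by fun_prop : Continuous fun t => y - t)).clm_apply continuous_const).aestronglyMeasurable

/-- A smooth cut-off between a compact set and an open set. -/
theorem exists_cutoff {K U : Set Plane} (hK : IsCompact K) (hU : IsOpen U) (hKU : K ⊆ U) :
    ∃ φ : Plane → ℝ, ContDiff ℝ ∞ φ ∧ HasCompactSupport φ ∧ tsupport φ ⊆ U ∧
      (∀ x ∈ K, φ =ᶠ[𝓝 x] fun _ => 1) ∧ ∀ x, φ x ∈ Icc (0 : ℝ) 1 := by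
  obtain ⟨L, hL, hKL, hLU⟩ := exists_compact_between hK hU hKU
  obtain ⟨f, h1, h0, hf⟩ := exists_contMDiffMap_one_nhds_of_subset_interior
    (modelWithCornersSelf ℝ Plane) (n := ⊤) hK.isClosed hKL
  have hsupp : tsupport f ⊆ L := closure_minimal
    (fun x hx => by by_contra h; exact hx (h0 x h)) hL.isClosed
  exact ⟨f, f.contMDiff.contDiff, hL.of_isClosed_subset (isClosed_tsupport _) hsupp,
    hsupp.trans hLU, fun x hx => eventually_nhdsSet_iff_forall.1 h1 x hx, hf⟩

/-- Homotopy invariance: the integral of the pull-back of a compactly supported density does not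
change along the segment from `h₀` to `h₁`, as long as the boundary values on that segment avoid
the support of the density. -/
theorem setIntegral_comp_mul_det_eq {Ω : Set Plane} (hΩ : IsOpen Ω) (hb : Bornology.IsBounded Ω)
    {h₀ h₁ : Plane → Plane} (hh₀ : ContDiff ℝ ∞ h₀) (hh₁ : ContDiff ℝ ∞ h₁)
    {w : Plane → ℝ} (hw : ContDiff ℝ ∞ w) (hc : HasCompactSupport w)
    (hfr : ∀ z ∈ frontier Ω, ∀ t ∈ Icc (0 : ℝ) 1, h₀ z + t • (h₁ z - h₀ z) ∉ tsupport w) :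
    ∫ x in Ω, w (h₀ x) * (fderiv ℝ h₀ x).det = ∫ x in Ω, w (h₁ x) * (fderiv ℝ h₁ x).det := by
  have hcl : IsCompact (closure Ω) := hb.isCompact_closure
  set H : ℝ × Plane → Plane := fun p => h₀ p.2 + p.1 • (h₁ p.2 - h₀ p.2) with hH
  have hHc : Continuous H := by
    have := hh₀.continuous; have := hh₁.continuous; fun_prop
  -- `K` is the set of points which the homotopy carries into the support of `w`
  set K : Set Plane := Prod.snd '' ((Icc (0 : ℝ) 1 ×ˢ closure Ω) ∩ H ⁻¹' tsupport w) with hK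
  have hKc : IsCompact K := ((isCompact_Icc.prod hcl).inter_right
    ((isClosed_tsupport w).preimage hHc)).image continuous_snd
  have hKmem {x : Plane} (hx : x ∈ closure Ω) {t : ℝ} (ht : t ∈ Icc (0 : ℝ) 1)
      (hxt : h₀ x + t • (h₁ x - h₀ x) ∈ tsupport w) : x ∈ K := ⟨(t, x), ⟨⟨ht, hx⟩, hxt⟩, rfl⟩
  have hKΩ : K ⊆ Ω := by
    rintro _ ⟨⟨t, x⟩, ⟨⟨ht, hx⟩, hxt⟩, rfl⟩
    by_contra hxΩ
    exact hfr x ⟨hx, by rwa [hΩ.interior_eq]⟩ t ht hxt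
  have hw0 {y : Plane} (hy : y ∉ tsupport w) : w y = 0 := image_eq_zero_of_notMem_tsupport hy
  obtain ⟨φ, hφ, hφc, hφΩ, hφ1, hφI⟩ := exists_cutoff hKc hΩ hKΩ
  obtain ⟨χ, hχ, hχc, hχΩ, hχ1, -⟩ := exists_cutoff hφc.isCompact hΩ hφΩ
  have hKφ : K ⊆ tsupport φ := fun x hx => subset_tsupport φ (by
    rw [Function.mem_support, (hφ1 x hx).self_of_nhds]; exact one_ne_zero)
  -- `h'` is `h₀` near `K` and `h₁` near the boundary
  set h' : Plane → Plane := fun x => h₀ x + (1 - φ x) • (h₁ x - h₀ x) with hh'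
  have hh's : ContDiff ℝ ∞ h' := hh₀.add ((contDiff_const.sub hφ).smul (hh₁.sub hh₀))
  have hI (x : Plane) : 1 - φ x ∈ Icc (0 : ℝ) 1 :=
    ⟨by linarith [(hφI x).2], by linarith [(hφI x).1]⟩
  have stepA : ∫ x in Ω, w (h₀ x) * (fderiv ℝ h₀ x).det
      = ∫ x in Ω, w (h' x) * (fderiv ℝ h' x).det := by
    refine setIntegral_congr_fun hΩ.measurableSet fun x hx => ?_
    by_cases hxK : x ∈ K
    · have : h' =ᶠ[𝓝 x] h₀ := by
        filter_upwards [hφ1 x hxK] with z hz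
        simp [hh', hz]
      simp only [this.self_of_nhds, this.fderiv_eq]
    · have h0 : w (h₀ x) = 0 := hw0 fun h => hxK
        (hKmem (subset_closure hx) (t := 0) (by simp) (by simpa using h))
      have h1 : w (h' x) = 0 := hw0 fun h => hxK (hKmem (subset_closure hx) (hI x) h)
      simp [h0, h1]
  have stepB {h : Plane → Plane} (ht : ∀ x, ∃ t ∈ Icc (0 : ℝ) 1, h x = h₀ x + t • (h₁ x - h₀ x)) :
      ∫ x in Ω, w (h x) * (fderiv ℝ h x).det = ∫ x, χ x * (w (h x) * (fderiv ℝ h x).det) := by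
    rw [← integral_indicator hΩ.measurableSet]
    congr with x
    by_cases hx : x ∈ Ω
    · rw [indicator_of_mem hx]
      by_cases hxK : x ∈ K
      · rw [(hχ1 x (hKφ hxK)).self_of_nhds, one_mul]
      · obtain ⟨t, ht, hxt⟩ := ht x
        have : w (h x) = 0 := hw0 fun h => hxK (hKmem (subset_closure hx) ht (hxt ▸ h))
        simp [this]
    · rw [indicator_of_notMem hx, image_eq_zero_of_notMem_tsupport fun h => hx (hχΩ h), zero_mul]
  obtain ⟨W, hW, hWw⟩ := exists_pderiv_zero_eq hw hc
  have stepC {h : Plane → Plane} (hh : ContDiff ℝ ∞ h) :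
      ∫ x, χ x * (w (h x) * (fderiv ℝ h x).det)
        = -∫ x, W (h x) * bracket χ (fun x => h x 1) x := by
    simp_rw [← hWw]
    exact integral_mul_pderiv_zero_comp (contDiff_infty.1 hW 1) hh (contDiff_infty.1 hχ 1) hχc
  rw [stepA, stepB fun x => ⟨_, hI x, rfl⟩, stepC hh's,
    stepB (h := h₁) fun x => ⟨1, by simp, by simp⟩, stepC hh₁]
  congr 2 with x
  by_cases hx : x ∈ tsupport φ
  · have hzero (v) : bracket χ v x = 0 := by
      rw [bracket_congr (hχ1 x hx) EventuallyEq.rfl]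
      simp [bracket, pderiv]
    simp [hzero]
  · have h0 : φ =ᶠ[𝓝 x] 0 := notMem_tsupport_iff_eventuallyEq.1 hx
    have : h' =ᶠ[𝓝 x] h₁ := by
      filter_upwards [h0] with z hz
      simp [hh', hz]
    rw [this.self_of_nhds, bracket_congr EventuallyEq.rfl
      (show (fun x => h' x 1) =ᶠ[𝓝 x] fun x => h₁ x 1 from this.fun_comp fun v => v 1)]

/-! ### Regular values -/

theorem continuous_det_fderiv {h : Plane → Plane} (hh : ContDiff ℝ ∞ h) :
    Continuous fun x => (fderiv ℝ h x).det :=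
  ContinuousLinearMap.continuous_det.comp (hh.continuous_fderiv (by simp))

theorem exists_open_injOn_of_det_ne_zero {h : Plane → Plane} (hh : ContDiff ℝ ∞ h) {p : Plane}
    (hp : (fderiv ℝ h p).det ≠ 0) {V : Set Plane} (hV : V ∈ 𝓝 p) :
    ∃ U ⊆ V, IsOpen U ∧ p ∈ U ∧ InjOn h U ∧ h '' U ∈ 𝓝 (h p) ∧
      ∀ x ∈ U, SignType.sign (fderiv ℝ h x).det = SignType.sign (fderiv ℝ h p).det := by
  have hs : HasStrictFDerivAt h
      ((fderiv ℝ h p).toContinuousLinearEquivOfDetNeZero hp : Plane →L[ℝ] Plane) p := by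
    simpa using (hh.contDiffAt (x := p)).hasStrictFDerivAt (by simp)
  have hsign : ∀ᶠ x in 𝓝 p,
      SignType.sign (fderiv ℝ h x).det = SignType.sign (fderiv ℝ h p).det := by
    have hc := (continuous_det_fderiv hh).continuousAt (x := p)
    rcases hp.lt_or_gt with h0 | h0
    · filter_upwards [hc.eventually_lt_const h0] with x hx
      rw [sign_neg hx, sign_neg h0]
    · filter_upwards [hc.eventually_const_lt h0] with x hx
      rw [sign_pos hx, sign_pos h0]
  set e := hs.toOpenPartialHomeomorph h with he
  have hsrc : e.source ∈ 𝓝 p := e.open_source.mem_nhds hs.mem_toOpenPartialHomeomorph_source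
  obtain ⟨U, hU, hUo, hpU⟩ := mem_nhds_iff.1 (inter_mem (inter_mem hsrc hV) hsign)
  refine ⟨U, fun x hx => (hU hx).1.2, hUo, hpU, ?_, ?_, fun x hx => (hU hx).2⟩
  · exact e.injOn.mono fun x hx => (hU hx).1.1
  · rw [← hs.map_nhds_eq_of_equiv]
    exact image_mem_map (hUo.mem_nhds hpU)

/-- Near a regular value `y`, the pull-back of a density has integral equal to the sign sum times
the integral of the density. -/
theorem exists_setIntegral_comp_mul_det_eq_signSum {Ω : Set Plane} (hΩ : IsOpen Ω)
    (hb : Bornology.IsBounded Ω) {h : Plane → Plane} (hh : ContDiff ℝ ∞ h) {y : Plane}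
    (hfr : ∀ z ∈ frontier Ω, h z ≠ y) (hreg : ∀ x ∈ Ω, h x = y → (fderiv ℝ h x).det ≠ 0) :
    ∃ δ > 0, ∀ w : Plane → ℝ, Continuous w → Function.support w ⊆ Metric.ball y δ →
      ∫ x in Ω, w (h x) * (fderiv ℝ h x).det = signSum h Ω y * ∫ z, w z := by
  have hcl : IsCompact (closure Ω) := hb.isCompact_closure
  set P : Set Plane := {x | x ∈ Ω ∧ h x = y} with hP
  have hPcl : P = closure Ω ∩ h ⁻¹' {y} := by
    ext x
    refine ⟨fun hx => ⟨subset_closure hx.1, hx.2⟩, fun hx => ⟨?_, hx.2⟩⟩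
    by_contra hxΩ
    exact hfr x ⟨hx.1, by rwa [hΩ.interior_eq]⟩ hx.2
  have hPc : IsCompact P := by
    rw [hPcl]; exact hcl.inter_right (isClosed_singleton.preimage hh.continuous)
  have hPf : P.Finite := by
    refine hPc.finite (isDiscrete_iff_forall_mem_exists_isOpen.2 fun p hp => ?_)
    obtain ⟨U, -, hUo, hpU, hinj, -⟩ := exists_open_injOn_of_det_ne_zero hh (hreg p hp.1 hp.2)
      univ_mem
    refine ⟨U, hUo, Subset.antisymm (fun x hx => hinj hx.1 hpU (hx.2.2.trans hp.2.symm)) ?_⟩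
    rintro _ rfl; exact ⟨hpU, hp⟩
  obtain ⟨V, hV, hVd⟩ := hPf.t2_separation
  have hex (p : Plane) : ∃ U : Set Plane, p ∈ P → U ⊆ V p ∩ Ω ∧ IsOpen U ∧ p ∈ U ∧ InjOn h U ∧
      h '' U ∈ 𝓝 (h p) ∧
      ∀ x ∈ U, SignType.sign (fderiv ℝ h x).det = SignType.sign (fderiv ℝ h p).det := by
    by_cases hp : p ∈ P
    · obtain ⟨U, hU⟩ := exists_open_injOn_of_det_ne_zero hh (hreg p hp.1 hp.2)
        (inter_mem ((hV p).2.mem_nhds (hV p).1) (hΩ.mem_nhds hp.1))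
      exact ⟨U, fun _ => hU⟩
    · exact ⟨∅, fun h => absurd h hp⟩
  choose U hU using hex
  set T : Set Plane := ⋃ p ∈ P, U p with hT
  have hTo : IsOpen T := isOpen_biUnion fun p hp => (hU p hp).2.1
  have hrest : IsCompact (h '' (closure Ω \ T)) := (hcl.diff hTo).image hh.continuous
  have hy : y ∉ h '' (closure Ω \ T) := by
    rintro ⟨x, ⟨hx, hxT⟩, hxy⟩
    have hxP : x ∈ P := by rw [hPcl]; exact ⟨hx, hxy⟩
    exact hxT (mem_biUnion hxP (hU x hxP).2.2.1)
  have hnhds : (h '' (closure Ω \ T))ᶜ ∩ ⋂ p ∈ P, h '' U p ∈ 𝓝 y := by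
    refine inter_mem (hrest.isClosed.isOpen_compl.mem_nhds hy) ?_
    rw [biInter_mem hPf]
    intro p hp
    have := (hU p hp).2.2.2.2.1
    rwa [hp.2] at this
  obtain ⟨δ, hδ, hball⟩ := Metric.mem_nhds_iff.1 hnhds
  refine ⟨δ, hδ, fun w hw hsupp => ?_⟩
  have hw0 {z : Plane} (hz : z ∉ Metric.ball y δ) : w z = 0 := by
    by_contra h; exact hz (hsupp h)
  have hTΩ : T ⊆ Ω := iUnion₂_subset fun p hp x hx => ((hU p hp).1 hx).2
  have hint : IntegrableOn (fun x => w (h x) * (fderiv ℝ h x).det) (closure Ω) :=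
    ((hw.comp hh.continuous).mul (continuous_det_fderiv hh)).continuousOn.integrableOn_compact hcl
  have h1 : ∫ x in Ω, w (h x) * (fderiv ℝ h x).det = ∫ x in T, w (h x) * (fderiv ℝ h x).det := by
    refine setIntegral_eq_of_subset_of_forall_sdiff_eq_zero
      (f := fun x => w (h x) * (fderiv ℝ h x).det) hΩ.measurableSet hTΩ fun x hx => ?_
    rw [hw0 fun hz => (hball hz).1 ⟨x, ⟨subset_closure hx.1, hx.2⟩, rfl⟩, zero_mul]
  have hTf : T = ⋃ p ∈ hPf.toFinset, U p := by simp [hT]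
  rw [h1, hTf, integral_biUnion_finset]
  · rw [signSum, finsum_mem_eq_finite_toFinset_sum _ hPf, Int.cast_sum, Finset.sum_mul]
    refine Finset.sum_congr rfl fun p hp => ?_
    have hpP : p ∈ P := hPf.mem_toFinset.1 hp
    obtain ⟨-, hUo, -, hinj, -, hsg⟩ := hU p hpP
    have h2 : ∫ x in U p, w (h x) * (fderiv ℝ h x).det
        = ∫ x in U p, ((SignType.sign (fderiv ℝ h p).det : ℤ) : ℝ) *
          (|(fderiv ℝ h x).det| • w (h x)) := by
      refine setIntegral_congr_fun hUo.measurableSet fun x hx => ?_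
      have := sign_mul_abs (fderiv ℝ h x).det
      rw [hsg x hx] at this
      simp only [smul_eq_mul]
      rw [← mul_assoc, SignType.intCast_cast, this, mul_comm]
    rw [h2, integral_const_mul, ← integral_image_eq_integral_abs_det_fderiv_smul volume
      hUo.measurableSet (fun x _ => (hh.differentiable (by simp) x).hasFDerivAt.hasFDerivWithinAt)
      hinj, setIntegral_eq_integral_of_forall_compl_eq_zero]
    intro z hz
    refine hw0 fun hzb => hz ?_
    exact mem_iInter₂.1 (hball hzb).2 p hpP
  · intro p hp
    exact (hU p (hPf.mem_toFinset.1 hp)).2.1.measurableSet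
  · intro p hp q hq hpq
    have hp' : p ∈ P := hPf.mem_toFinset.1 hp
    have hq' : q ∈ P := hPf.mem_toFinset.1 hq
    exact (hVd hp' hq' hpq).mono (fun x hx => ((hU p hp').1 hx).1) fun x hx => ((hU q hq').1 hx).1
  · intro p hp
    exact hint.mono_set fun x hx =>
      subset_closure ((hU p (hPf.mem_toFinset.1 hp)).1 hx).2

/-! ### Rescaled mollification kernels -/

/-- The kernel `η` rescaled to the disc of radius `δ`, keeping its integral. -/
noncomputable def kernel (η : Plane → ℝ) (δ : ℝ) (z : Plane) : ℝ := (δ ^ 2)⁻¹ * η (δ⁻¹ • z)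

namespace IsMollifier

variable {η : Plane → ℝ} (hη : IsMollifier η)

include hη

theorem contDiff_kernel (δ : ℝ) : ContDiff ℝ ∞ (kernel η δ) :=
  contDiff_const.mul (hη.contDiff.comp (contDiff_const_smul _))

theorem kernel_nonneg (δ : ℝ) (z : Plane) : 0 ≤ kernel η δ z :=
  mul_nonneg (by positivity) (hη.nonneg _)

theorem support_kernel {δ : ℝ} (hδ : 0 < δ) :
    Function.support (kernel η δ) ⊆ Metric.closedBall 0 δ := by
  intro z hz
  have h1 : η (δ⁻¹ • z) ≠ 0 := fun h => hz (by simp [kernel, h])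
  have h2 := hη.support_subset h1
  rw [mem_closedBall_zero_iff, norm_smul, norm_inv, Real.norm_of_nonneg hδ.le,
    inv_mul_le_one₀ hδ] at h2
  simpa using h2

theorem kernel_eq_zero {δ : ℝ} (hδ : 0 < δ) {z : Plane} (hz : δ < ‖z‖) : kernel η δ z = 0 := by
  by_contra h
  have := hη.support_kernel hδ h
  rw [mem_closedBall_zero_iff] at this
  linarith

theorem tsupport_kernel {δ : ℝ} (hδ : 0 < δ) : tsupport (kernel η δ) ⊆ Metric.closedBall 0 δ :=
  closure_minimal (hη.support_kernel hδ) Metric.isClosed_closedBall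

theorem hasCompactSupport_kernel {δ : ℝ} (hδ : 0 < δ) : HasCompactSupport (kernel η δ) :=
  (isCompact_closedBall _ _).of_isClosed_subset (isClosed_tsupport _) (hη.tsupport_kernel hδ)

theorem integral_kernel {δ : ℝ} (hδ : 0 < δ) : ∫ z, kernel η δ z = 1 := by
  simp only [kernel]
  rw [integral_const_mul, Measure.integral_comp_inv_smul_of_nonneg volume η hδ.le,
    hη.integral_eq_one]
  simp [hδ.ne']

end IsMollifier

theorem exists_isMollifier : ∃ η, IsMollifier η := by
  let b : ContDiffBump (0 : Plane) := ⟨1 / 2, 1, by norm_num, by norm_num⟩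
  refine ⟨b.normed volume, b.contDiff_normed, b.nonneg_normed, ?_, b.integral_normed⟩
  rw [b.support_normed_eq]
  exact Metric.ball_subset_closedBall

/-! ### The degree as an integral -/

/-- The integral over `Ω` of the pull-back under `h` of the kernel of radius `δ` centered at `y`.
It equals the degree of `h` at `y` as soon as `h (∂Ω)` is further than `δ` away from `y`. -/
noncomputable def kernelDegree (η : Plane → ℝ) (δ : ℝ) (h : Plane → Plane) (Ω : Set Plane)
    (y : Plane) : ℝ := ∫ x in Ω, kernel η δ (h x - y) * (fderiv ℝ h x).det

section KernelDegree

variable {η : Plane → ℝ} (hη : IsMollifier η) {Ω : Set Plane} (hΩ : IsOpen Ω)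
  (hb : Bornology.IsBounded Ω) {y : Plane}

include hη hΩ hb

theorem kernelDegree_eq_of_homotopy {δ : ℝ} (hδ : 0 < δ) {h₀ h₁ : Plane → Plane}
    (hh₀ : ContDiff ℝ ∞ h₀) (hh₁ : ContDiff ℝ ∞ h₁)
    (hfr : ∀ z ∈ frontier Ω, ∀ t ∈ Icc (0 : ℝ) 1, δ < ‖h₀ z + t • (h₁ z - h₀ z) - y‖) :
    kernelDegree η δ h₀ Ω y = kernelDegree η δ h₁ Ω y := by
  have hsub : tsupport (fun v => kernel η δ (v - y)) ⊆ Metric.closedBall y δ := by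
    refine closure_minimal (fun v hv => ?_) Metric.isClosed_closedBall
    have := hη.support_kernel hδ hv
    simpa [dist_eq_norm] using this
  refine setIntegral_comp_mul_det_eq (w := fun v => kernel η δ (v - y)) hΩ hb hh₀ hh₁
    ((hη.contDiff_kernel δ).comp (contDiff_id.sub contDiff_const))
    ((isCompact_closedBall _ _).of_isClosed_subset (isClosed_tsupport _) hsub)
    fun z hz t ht hmem => ?_
  have h1 := hsub hmem
  rw [Metric.mem_closedBall, dist_eq_norm] at h1
  exact absurd h1 (hfr z hz t ht).not_ge

/-- The kernel integral does not depend on the radius: a dilation of the target is a homotopy. -/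
theorem kernelDegree_eq_of_le {δ δ' : ℝ} (hδ : 0 < δ) (hδδ' : δ ≤ δ') {h : Plane → Plane}
    (hh : ContDiff ℝ ∞ h) (hfr : ∀ z ∈ frontier Ω, δ' < ‖h z - y‖) :
    kernelDegree η δ h Ω y = kernelDegree η δ' h Ω y := by
  -- dilate the target about `y` by the factor `l`
  set l : ℝ := δ' / δ with hl
  have hδ' : 0 < δ' := hδ.trans_le hδδ'
  have hl1 : 1 ≤ l := (one_le_div hδ).2 hδδ'
  have hsm : ContDiff ℝ ∞ fun x => y + l • (h x - y) := by fun_prop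
  rw [kernelDegree_eq_of_homotopy hη hΩ hb hδ' hh hsm fun z hz t ht => ?_]
  · refine setIntegral_congr_fun hΩ.measurableSet fun x _ => ?_
    have hd : fderiv ℝ (fun x => y + l • (h x - y)) x = l • fderiv ℝ h x := by
      have := hh.differentiable (by simp) x
      rw [fderiv_const_add, fderiv_fun_const_smul (by fun_prop), fderiv_sub_const]
    have hdet : (l • fderiv ℝ h x).det = l ^ 2 * (fderiv ℝ h x).det := by
      rw [ContinuousLinearMap.det, ContinuousLinearMap.toLinearMap_smul, LinearMap.det_smul]
      simp [ContinuousLinearMap.det]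
    simp only [hd, hdet, kernel, add_sub_cancel_left, smul_smul]
    have h1 : δ'⁻¹ * l = δ⁻¹ := by rw [hl]; field_simp
    rw [h1, hl]
    field_simp
  · have h1 : h z + t • (y + l • (h z - y) - h z) - y = (1 + t * (l - 1)) • (h z - y) := by
      module
    have h2 : (1 : ℝ) ≤ 1 + t * (l - 1) := by nlinarith [ht.1]
    rw [h1, norm_smul, Real.norm_of_nonneg (by linarith)]
    nlinarith [hfr z hz, norm_nonneg (h z - y)]

theorem kernelDegree_eq_signSum {δ : ℝ} (hδ : 0 < δ) {h : Plane → Plane}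
    (hh : ContDiff ℝ ∞ h) (hfr : ∀ z ∈ frontier Ω, δ < ‖h z - y‖)
    (hreg : ∀ x ∈ Ω, h x = y → (fderiv ℝ h x).det ≠ 0) :
    kernelDegree η δ h Ω y = signSum h Ω y := by
  obtain ⟨δ₀, hδ₀, H⟩ := exists_setIntegral_comp_mul_det_eq_signSum hΩ hb hh
    (fun z hz hzy => by have := hfr z hz; simp [hzy] at this; linarith) hreg
  set δ₁ := min δ (δ₀ / 2) with hδ₁
  have hδ₁0 : 0 < δ₁ := lt_min hδ (by linarith)
  rw [← kernelDegree_eq_of_le hη hΩ hb hδ₁0 (min_le_left _ _) hh hfr, kernelDegree,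
    H (fun v => kernel η δ₁ (v - y))
      ((hη.contDiff_kernel δ₁).continuous.comp (continuous_id.sub continuous_const))]
  · rw [integral_sub_right_eq_self (kernel η δ₁) y, hη.integral_kernel hδ₁0, mul_one]
  · intro v hv
    have h1 := hη.support_kernel hδ₁0 hv
    rw [mem_closedBall_zero_iff, ← dist_eq_norm] at h1
    rw [Metric.mem_ball]
    linarith [min_le_right δ (δ₀ / 2)]

theorem signSum_eq_of_isRegularApprox {f h₀ h₁ : Plane → Plane} (H₀ : IsRegularApprox f Ω y h₀)
    (H₁ : IsRegularApprox f Ω y h₁) : signSum h₀ Ω y = signSum h₁ Ω y := by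
  have hfrc : IsCompact (frontier Ω) :=
    hb.isCompact_closure.of_isClosed_subset isClosed_frontier frontier_subset_closure
  obtain ⟨δ₀, hδ₀, hc₀⟩ := H₀.close
  obtain ⟨δ₁, hδ₁, hc₁⟩ := H₁.close
  have hcont : Continuous fun p : ℝ × Plane => ‖h₀ p.2 + p.1 • (h₁ p.2 - h₀ p.2) - y‖ := by
    have := H₀.contDiff.continuous; have := H₁.contDiff.continuous; fun_prop
  have hpos : ∀ p ∈ Icc (0 : ℝ) 1 ×ˢ frontier Ω,
      0 < ‖h₀ p.2 + p.1 • (h₁ p.2 - h₀ p.2) - y‖ := by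
    rintro ⟨t, z⟩ ⟨ht, hz⟩
    simp only at ht hz ⊢
    have ha : ‖h₀ z - f z‖ < ‖f z - y‖ := by
      rw [← dist_eq_norm, ← dist_eq_norm]
      exact (hc₀ z (frontier_subset_closure hz)).trans_le (hδ₀ z hz)
    have hb : ‖h₁ z - f z‖ < ‖f z - y‖ := by
      rw [← dist_eq_norm, ← dist_eq_norm]
      exact (hc₁ z (frontier_subset_closure hz)).trans_le (hδ₁ z hz)
    have hd : h₀ z + t • (h₁ z - h₀ z) ∈ Metric.ball (f z) ‖f z - y‖ := by
      have := (convex_ball (f z) ‖f z - y‖).add_smul_sub_mem (x := h₀ z) (y := h₁ z)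
        (by rwa [Metric.mem_ball, dist_eq_norm]) (by rwa [Metric.mem_ball, dist_eq_norm]) ht
      exact this
    rw [norm_pos_iff, sub_ne_zero]
    intro h
    rw [h, Metric.mem_ball, dist_comm, dist_eq_norm] at hd
    exact lt_irrefl _ hd
  obtain ⟨m, hm, hmin⟩ := (isCompact_Icc.prod hfrc).exists_forall_le' hcont.continuousOn hpos
  have hlt : ∀ z ∈ frontier Ω, ∀ t ∈ Icc (0 : ℝ) 1, m / 2 < ‖h₀ z + t • (h₁ z - h₀ z) - y‖ :=
    fun z hz t ht => (half_lt_self hm).trans_le (hmin (t, z) ⟨ht, hz⟩)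
  have := kernelDegree_eq_of_homotopy hη hΩ hb (half_pos hm) H₀.contDiff H₁.contDiff hlt
  rw [kernelDegree_eq_signSum hη hΩ hb (half_pos hm) H₀.contDiff
      (fun z hz => by simpa using hlt z hz 0 (by simp)) H₀.regular,
    kernelDegree_eq_signSum hη hΩ hb (half_pos hm) H₁.contDiff
      (fun z hz => by simpa using hlt z hz 1 (by simp)) H₁.regular] at this
  exact_mod_cast this

omit hη hΩ hb in
/-- Almost every translate of a smooth map has `y` as a regular value, by Sard's lemma. -/
theorem exists_regular_translate {h : Plane → Plane} (hh : ContDiff ℝ ∞ h) (y : Plane) {ε : ℝ}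
    (hε : 0 < ε) : ∃ v : Plane, ‖v‖ < ε ∧ ∀ x, h x + v = y → (fderiv ℝ h x).det ≠ 0 := by
  have hnull : volume (h '' {x | (fderiv ℝ h x).det = 0}) = 0 :=
    addHaar_image_eq_zero_of_det_fderivWithin_eq_zero volume
      (fun x _ => (hh.differentiable (by simp) x).hasFDerivAt.hasFDerivWithinAt) fun x hx => hx
  have hnsub : ¬ Metric.ball y ε ⊆ h '' {x | (fderiv ℝ h x).det = 0} := fun hsub =>
    (Metric.measure_ball_pos volume y hε).ne' (measure_mono_null hsub hnull)
  obtain ⟨z, hz, hzn⟩ := not_subset.1 hnsub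
  refine ⟨y - z, by rwa [← dist_eq_norm, dist_comm], fun x hx h0 => hzn ⟨x, h0, ?_⟩⟩
  rw [← sub_eq_zero, ← sub_eq_zero.2 hx]
  abel

/-- The degree of `f` at `y` is given by the kernel integral of any smooth map `h` near `f`. -/
theorem kernelDegree_eq_topDegree {f h : Plane → Plane} (hh : ContDiff ℝ ∞ h) {s δ : ℝ}
    (hδ : 0 < δ) (hclose : ∀ x ∈ closure Ω, dist (h x) (f x) ≤ s)
    (hfr : ∀ z ∈ frontier Ω, s + δ < dist (f z) y) :
    kernelDegree η δ h Ω y = topDegree f Ω y := by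
  have hfrc : IsCompact (frontier Ω) :=
    hb.isCompact_closure.of_isClosed_subset isClosed_frontier frontier_subset_closure
  have hlt : ∀ z ∈ frontier Ω, δ < ‖h z - y‖ := fun z hz => by
    have h1 := hfr z hz
    have h2 := hclose z (frontier_subset_closure hz)
    have h3 := dist_triangle (f z) (h z) y
    rw [dist_comm (f z) (h z)] at h3
    rw [← dist_eq_norm]
    linarith
  obtain ⟨m, hm, hmin⟩ := hfrc.exists_forall_le'
    (f := fun z => ‖h z - y‖) (by have := hh.continuous; fun_prop) hlt
  obtain ⟨v, hv, hreg⟩ := exists_regular_translate hh y (lt_min (sub_pos.2 hm) hδ)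
  have hvm : ‖v‖ < m - δ := hv.trans_le (min_le_left _ _)
  have hvδ : ‖v‖ < δ := hv.trans_le (min_le_right _ _)
  set h' : Plane → Plane := fun x => h x + v with hh'
  have hh's : ContDiff ℝ ∞ h' := hh.add contDiff_const
  have happ : IsRegularApprox f Ω y h' := by
    refine ⟨hh's, ⟨s + δ, fun z hz => (hfr z hz).le, fun x hx => ?_⟩, fun x _ hx => ?_⟩
    · have h1 := hclose x hx
      have h2 := dist_triangle (h x + v) (h x) (f x)
      rw [dist_self_add_left] at h2
      linarith
    · have := hreg x hx
      rwa [hh', fderiv_add_const]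
  have hdist : ∀ z ∈ frontier Ω, ∀ t ∈ Icc (0 : ℝ) 1, δ < ‖h z + t • (h' z - h z) - y‖ := by
    intro z hz t ht
    have h1 : h z + t • (h' z - h z) - y = (h z - y) + t • v := by simp only [hh']; module
    have h2 := norm_sub_le_norm_add (h z - y) (t • v)
    have h3 : ‖t • v‖ ≤ ‖v‖ := by
      rw [norm_smul, Real.norm_of_nonneg ht.1]
      exact mul_le_of_le_one_left (norm_nonneg _) ht.2
    have h4 := hmin z hz
    rw [h1]
    linarith
  have hdeg : IsDegree f Ω y (signSum h' Ω y) :=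
    ⟨⟨h', happ⟩, fun h'' H => signSum_eq_of_isRegularApprox hη hΩ hb H happ⟩
  have hex : ∃ d, IsDegree f Ω y d := ⟨_, hdeg⟩
  have htop : topDegree f Ω y = signSum h' Ω y := by
    rw [topDegree, dif_pos hex]
    exact (hex.choose_spec.2 h' happ).symm
  rw [htop, kernelDegree_eq_of_homotopy hη hΩ hb hδ hh hh's hdist,
    kernelDegree_eq_signSum hη hΩ hb hδ hh's (fun z hz => by simpa using hdist z hz 1 (by simp))
      happ.regular]

end KernelDegree

/-! ### Mollification of continuous maps -/

theorem mollify_top (η : Plane → ℝ) (ε : ℝ) (f : Plane → Plane) (x : Plane) :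
    mollify η ε ⊤ f x = ∫ z, kernel η ε (x - z) • f z := by
  simp [mollify, kernel]

theorem mollify_top_eq_convolution (η : Plane → ℝ) (ε : ℝ) (f : Plane → Plane) :
    mollify η ε ⊤ f = convolution (kernel η ε) f (ContinuousLinearMap.lsmul ℝ ℝ) volume := by
  ext1 x
  rw [mollify_top, convolution_lsmul_swap]

/-- Away from the boundary of `Ω`, the mollification only sees the values on `Ω`. -/
theorem mollify_eq_mollify_top {η : Plane → ℝ} (hη : IsMollifier η) {ε : ℝ} (hε : 0 < ε)
    {Ω : Opens Plane} {g f : Plane → Plane} (hgf : ∀ x ∈ Ω, f x = g x) {x : Plane}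
    (hx : Metric.closedBall x ε ⊆ Ω) : mollify η ε Ω g x = mollify η ε ⊤ f x := by
  rw [mollify_top, mollify, ← setIntegral_eq_integral_of_forall_compl_eq_zero
    (s := (Ω : Set Plane)) (f := fun z => kernel η ε (x - z) • f z)]
  · exact setIntegral_congr_fun Ω.isOpen.measurableSet fun z hz => by simp only [hgf z hz, kernel]
  · intro z hz
    rw [hη.kernel_eq_zero hε, zero_smul]
    by_contra h
    exact hz (hx (by rwa [Metric.mem_closedBall', dist_eq_norm, ← not_lt]))

section Mollify

variable {η : Plane → ℝ} (hη : IsMollifier η) {f : Plane → Plane} (hf : Continuous f)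

include hη hf

theorem contDiff_mollify {ε : ℝ} (hε : 0 < ε) : ContDiff ℝ ∞ (mollify η ε ⊤ f) := by
  rw [mollify_top_eq_convolution]
  exact (hη.hasCompactSupport_kernel hε).contDiff_convolution_left _ (hη.contDiff_kernel ε)
    hf.locallyIntegrable

theorem dist_mollify_le {ε κ : ℝ} (hε : 0 < ε) (hκ : 0 ≤ κ)
    (hfκ : ∀ x z, dist x z < 2 * ε → dist (f x) (f z) ≤ κ) (x : Plane) :
    dist (mollify η ε ⊤ f x) (f x) ≤ κ := by
  rw [mollify_top_eq_convolution]
  refine dist_convolution_le hκ ((hη.support_kernel hε).trans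
    (Metric.closedBall_subset_ball (by linarith : ε < 2 * ε))) (hη.kernel_nonneg ε)
    (hη.integral_kernel hε) hf.aestronglyMeasurable fun z hz => ?_
  exact hfκ z x hz

/-- The mollifications of a uniformly continuous map converge uniformly. -/
theorem eventually_dist_mollify_le (hu : UniformContinuous f) {κ : ℝ} (hκ : 0 < κ) :
    ∀ᶠ ε in 𝓝[>] (0 : ℝ), ∀ x, dist (mollify η ε ⊤ f x) (f x) ≤ κ := by
  obtain ⟨δ, hδ, H⟩ := Metric.uniformContinuous_iff.1 hu κ hκ
  filter_upwards [Ioo_mem_nhdsGT (half_pos hδ)] with ε hε x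
  exact dist_mollify_le hη hf hε.1 hκ.le (fun a b hab => (H (by linarith [hε.2])).le) x

theorem pderiv_mollify {ε : ℝ} (hε : 0 < ε) (i j : Fin 2) (x : Plane) :
    pderiv i (fun x => mollify η ε ⊤ f x j) x = ∫ z, f z j * pderiv i (kernel η ε) (x - z) := by
  have hk := hη.contDiff_kernel ε
  have hkc := hη.hasCompactSupport_kernel hε
  have hfj : Continuous fun z => f z j := by fun_prop
  have hint (x : Plane) : Integrable fun z => kernel η ε (x - z) • f z := by
    have h1 : Continuous fun z => kernel η ε (x - z) :=
      hk.continuous.comp (continuous_const.sub continuous_id)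
    have h2 : HasCompactSupport fun z => kernel η ε (x - z) :=
      hkc.comp_homeomorph (Homeomorph.subLeft x)
    exact (h1.smul hf).integrable_of_hasCompactSupport h2.smul_right
  have h1 : (fun x => mollify η ε ⊤ f x j)
      = convolution (fun z => f z j) (kernel η ε) (ContinuousLinearMap.lsmul ℝ ℝ) volume := by
    ext1 x
    rw [mollify_top, convolution]
    have := ContinuousLinearMap.integral_comp_comm (EuclideanSpace.proj (𝕜 := ℝ) j) (hint x)
    simp only [PiLp.proj_apply] at this
    rw [← this]
    congr with z
    simp [mul_comm]
  have h2 := hkc.hasFDerivAt_convolution_right (ContinuousLinearMap.lsmul ℝ ℝ)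
    hfj.locallyIntegrable (μ := volume) (contDiff_infty.1 hk 1) x
  have hint' : Integrable fun z => (ContinuousLinearMap.precompR Plane
      (ContinuousLinearMap.lsmul ℝ ℝ) (f z j)) (fderiv ℝ (kernel η ε) (x - z)) := by
    refine Continuous.integrable_of_hasCompactSupport ?_ ?_
    · have := hk.continuous_fderiv (by simp)
      exact ((ContinuousLinearMap.continuous _).comp hfj).clm_apply
        (this.comp (continuous_const.sub continuous_id))
    · refine ((hkc.fderiv (𝕜 := ℝ)).comp_homeomorph (Homeomorph.subLeft x)).mono fun z hz => ?_
      contrapose! hz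
      simp only [Function.mem_support, Function.comp_apply, Homeomorph.coe_subLeft, not_not] at hz ⊢
      rw [hz, map_zero]
  rw [pderiv, h1, h2.fderiv, convolution, ContinuousLinearMap.integral_apply hint']
  rfl

end Mollify

/-! ### Mollification of maps of bounded variation -/

/-- A vector measure with values in a Euclidean space has finite variation. -/
theorem isFiniteMeasure_variation (Dg : VectorMeasure Plane PlaneMatrix) :
    IsFiniteMeasure Dg.variation := by
  set S : Fin 2 × Fin 2 → SignedMeasure Plane := fun p =>
    Dg.mapRange (EuclideanSpace.proj (𝕜 := ℝ) p : PlaneMatrix →L[ℝ] ℝ).toLinearMap.toAddMonoidHom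
      (EuclideanSpace.proj (𝕜 := ℝ) p).continuous with hS
  have hfin (p) : IsFiniteMeasure (S p).variation := by
    rw [← SignedMeasure.totalVariation_eq_variation]; infer_instance
  have hle : Dg.variation ≤ ∑ p, (S p).variation := by
    refine VectorMeasure.variation_le_of_forall_enorm_le fun E _ => ?_
    rw [Measure.coe_finsetSum, Finset.sum_apply]
    have h1 : Dg E = ∑ p, EuclideanSpace.single p (S p E) := by
      ext p
      simp only [WithLp.ofLp_sum, Finset.sum_apply, PiLp.single_apply,
        Finset.sum_ite_eq, Finset.mem_univ, if_true]
      rfl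
    calc ‖Dg E‖ₑ ≤ ∑ p, ‖(EuclideanSpace.single p (S p E) : PlaneMatrix)‖ₑ := by
          conv_lhs => rw [h1]
          exact enorm_sum_le _ _
      _ ≤ _ := Finset.sum_le_sum fun p _ => by
          have h2 : ‖(EuclideanSpace.single p (S p E) : PlaneMatrix)‖ₑ = ‖S p E‖ₑ := by
            rw [← ofReal_norm, ← ofReal_norm, PiLp.norm_single]
          rw [h2]
          exact VectorMeasure.enorm_measure_le_variation _ _
  exact isFiniteMeasure_of_le _ hle

section BV

variable {η : Plane → ℝ} (hη : IsMollifier η) {f g : Plane → Plane} (hf : Continuous f)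
  {Ω : Opens Plane} (hfg : ∀ x ∈ Ω, f x = g x) {Dg : VectorMeasure Plane PlaneMatrix}
  (hDg : IsDistribDeriv Ω g Dg)

include hη hf hfg hDg

/-- The derivative of the mollification is the mollification of the measure `Dg`. -/
theorem pderiv_mollify_eq_vectorIntegral {ε : ℝ} (hε : 0 < ε) {x : Plane}
    (hx : Metric.closedBall x ε ⊆ Ω) (i j : Fin 2) :
    pderiv i (fun x => mollify η ε ⊤ f x j) x
      = (∫ᵛ z in (Ω : Set Plane), kernel η ε (x - z) ∂•Dg) (j, i) := by
  have hk := hη.contDiff_kernel ε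
  have hsupp : tsupport (fun z => kernel η ε (x - z)) ⊆ Metric.closedBall x ε := by
    refine closure_minimal (fun z hz => ?_) Metric.isClosed_closedBall
    have := hη.support_kernel hε hz
    rwa [mem_closedBall_zero_iff, ← dist_eq_norm, ← Metric.mem_closedBall'] at this
  let φ : 𝓓(Ω, ℝ) := ⟨fun z => kernel η ε (x - z), hk.comp (contDiff_const.sub contDiff_id),
    (isCompact_closedBall x ε).of_isClosed_subset (isClosed_tsupport _) hsupp, hsupp.trans hx⟩
  have hφ (z : Plane) : fderiv ℝ φ z (EuclideanSpace.single i 1)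
      = -pderiv i (kernel η ε) (x - z) := by
    change fderiv ℝ (fun z => kernel η ε (x - z)) z _ = _
    have h1 : HasFDerivAt (fun z => x - z) (-ContinuousLinearMap.id ℝ Plane) z :=
      (hasFDerivAt_id z).const_sub x
    have h2 : HasFDerivAt (fun z => kernel η ε (x - z)) _ z :=
      (hk.differentiable (by simp) (x - z)).hasFDerivAt.comp z h1
    rw [h2.fderiv]
    simp [pderiv]
  have h1 := hDg φ i j
  simp only [hφ] at h1
  rw [← neg_eq_iff_eq_neg, ← integral_neg] at h1
  simp only [mul_neg, neg_neg] at h1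
  refine Eq.trans ?_ h1
  rw [pderiv_mollify hη hf hε, ← setIntegral_eq_integral_of_forall_compl_eq_zero
    (s := (Ω : Set Plane))]
  · exact setIntegral_congr_fun Ω.isOpen.measurableSet fun z hz => by simp only [hfg z hz]
  · intro z hz
    have hzn : x - z ∉ tsupport (pderiv i (kernel η ε)) := fun h => hz (hx (by
      have := hη.tsupport_kernel hε (tsupport_pderiv_subset _ i h)
      rwa [mem_closedBall_zero_iff, ← dist_eq_norm, ← Metric.mem_closedBall'] at this))
    rw [image_eq_zero_of_notMem_tsupport hzn, mul_zero]

/-- The derivative of the mollification is controlled in `L¹` by the variation of `Dg`. -/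
theorem lintegral_pderiv_mollify_le {ε : ℝ} (hε : 0 < ε) {A B : Set Plane} (hA : MeasurableSet A)
    (hB : MeasurableSet B) (hBΩ : B ⊆ Ω) (hAB : ∀ x ∈ A, Metric.closedBall x ε ⊆ B)
    (i j : Fin 2) :
    ∫⁻ x in A, ‖pderiv i (fun x => mollify η ε ⊤ f x j) x‖ₑ ≤ Dg.variation B := by
  have := isFiniteMeasure_variation Dg
  have hkm : Measurable fun p : Plane × Plane => ‖kernel η ε (p.1 - p.2)‖ₑ :=
    ((hη.contDiff_kernel ε).continuous.comp (by fun_prop)).measurable.enorm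
  calc ∫⁻ x in A, ‖pderiv i (fun x => mollify η ε ⊤ f x j) x‖ₑ
      ≤ ∫⁻ x in A, (∫⁻ z in B, ‖kernel η ε (x - z)‖ₑ ∂Dg.variation) := by
        refine setLIntegral_mono' hA fun x hx => ?_
        rw [pderiv_mollify_eq_vectorIntegral hη hf hfg hDg hε ((hAB x hx).trans hBΩ)]
        have h1 : ‖(∫ᵛ z in (Ω : Set Plane), kernel η ε (x - z) ∂•Dg) (j, i)‖ₑ
            ≤ ‖∫ᵛ z in (Ω : Set Plane), kernel η ε (x - z) ∂•Dg‖ₑ := by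
          rw [← ofReal_norm, ← ofReal_norm]
          exact ENNReal.ofReal_le_ofReal (PiLp.norm_apply_le _ _)
        refine h1.trans (VectorMeasure.enorm_integral_le_lintegral_enorm_transpose.trans ?_)
        rw [VectorMeasure.variation_transpose_lsmul,
          VectorMeasure.variation_restrict Ω.isOpen.measurableSet,
          ← lintegral_indicator Ω.isOpen.measurableSet, ← lintegral_indicator hB]
        refine lintegral_mono fun z => ?_
        by_cases hz : z ∈ B
        · simp [indicator_of_mem hz, indicator_of_mem (hBΩ hz)]
        · have h0 : kernel η ε (x - z) = 0 := by
            refine hη.kernel_eq_zero hε ?_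
            by_contra h
            exact hz (hAB x hx (by rwa [Metric.mem_closedBall', dist_eq_norm, ← not_lt]))
          simp [indicator, h0]
    _ = ∫⁻ z in B, (∫⁻ x in A, ‖kernel η ε (x - z)‖ₑ) ∂Dg.variation :=
        lintegral_lintegral_swap hkm.aemeasurable
    _ ≤ ∫⁻ _ in B, 1 ∂Dg.variation := by
        refine lintegral_mono fun z => (setLIntegral_le_lintegral _ _).trans ?_
        rw [lintegral_sub_right_eq_self (fun x => ‖kernel η ε x‖ₑ) z]
        have h2 : Integrable (kernel η ε) := integrable_of_integral_eq_one (hη.integral_kernel hε)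
        rw [← ofReal_integral_norm_eq_lintegral_enorm h2]
        simp_rw [Real.norm_of_nonneg (hη.kernel_nonneg ε _)]
        simp [hη.integral_kernel hε]
    _ = Dg.variation B := by simp

end BV

/-! ### The distributional Jacobian of a continuous map of bounded variation -/

theorem integrable_restrict_variation {Dg : VectorMeasure Plane PlaneMatrix} {Ω : Opens Plane}
    {u : Plane → ℝ} (hu : Continuous u) {C : ℝ} (hC : ∀ x, |u x| ≤ C) :
    (Dg.restrict (Ω : Set Plane)).Integrable u := by
  have := isFiniteMeasure_variation Dg
  exact Integrable.of_bound hu.aestronglyMeasurable C (Eventually.of_forall hC)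

theorem abs_vectorIntegral_le {Dg : VectorMeasure Plane PlaneMatrix} {Ω : Opens Plane}
    {u : Plane → ℝ} {C : ℝ} (hC : ∀ x, |u x| ≤ C) (p : Fin 2 × Fin 2) :
    |(∫ᵛ x in (Ω : Set Plane), u x ∂•Dg) p| ≤ C * (Dg.variation Ω).toReal := by
  have := isFiniteMeasure_variation Dg
  have hC0 : 0 ≤ C := (abs_nonneg _).trans (hC 0)
  have h1 := VectorMeasure.norm_integral_le_of_norm_le_const (μ := Dg.restrict (Ω : Set Plane))
    (B := ContinuousLinearMap.lsmul ℝ ℝ) (f := u) (Eventually.of_forall hC)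
  have h2 : (Dg.restrict (Ω : Set Plane)).variation.real univ = (Dg.variation Ω).toReal := by
    rw [VectorMeasure.variation_restrict Ω.isOpen.measurableSet]
    simp [Measure.real]
  rw [h2] at h1
  refine (PiLp.norm_apply_le (∫ᵛ x in (Ω : Set Plane), u x ∂•Dg) p).trans (h1.trans ?_)
  gcongr
  exact mul_le_of_le_one_right hC0 ContinuousLinearMap.opNorm_lsmul_le

/-- The functional `u ↦ ∫ v u dD_i g_j` (with `p = (j, i)`) on bounded continuous functions. -/
noncomputable def entryIntegralCLM (Ω : Opens Plane) (Dg : VectorMeasure Plane PlaneMatrix)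
    (v : BoundedContinuousFunction Plane ℝ) (p : Fin 2 × Fin 2) :
    BoundedContinuousFunction Plane ℝ →L[ℝ] ℝ :=
  LinearMap.mkContinuous
    { toFun := fun u => (∫ᵛ x in (Ω : Set Plane), v x * u x ∂•Dg) p
      map_add' := fun u w => by
        have hi (u : BoundedContinuousFunction Plane ℝ) :
            (Dg.restrict (Ω : Set Plane)).Integrable fun x => v x * u x :=
          integrable_restrict_variation (v * u).continuous (v * u).norm_coe_le_norm
        simp only [BoundedContinuousFunction.coe_add, Pi.add_apply, mul_add]
        rw [VectorMeasure.integral_fun_add (hi u) (hi w)]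
        rfl
      map_smul' := fun c u => by
        simp only [BoundedContinuousFunction.coe_smul, smul_eq_mul, RingHom.id_apply,
          mul_left_comm _ c]
        exact congrArg (fun w : PlaneMatrix => w p)
          (VectorMeasure.integral_fun_smul (Dg.restrict (Ω : Set Plane))
            (ContinuousLinearMap.lsmul ℝ ℝ) c fun x => v x * u x) }
    (‖v‖ * (Dg.variation Ω).toReal) fun u => by
      have h := abs_vectorIntegral_le (Dg := Dg) (Ω := Ω) (u := fun x => v x * u x)
        (C := ‖v‖ * ‖u‖) (fun x => by
          rw [abs_mul]
          exact mul_le_mul (v.norm_coe_le_norm x) (u.norm_coe_le_norm x) (abs_nonneg _)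
            (norm_nonneg _)) p
      refine h.trans_eq (by ring)

/-- The distribution `φ ↦ - ∫ v dφ ∧ Dg₁`. If `v = g₀` it is the distributional Jacobian of `g`. -/
noncomputable def jacobianDistribution (Ω : Opens Plane) (Dg : VectorMeasure Plane PlaneMatrix)
    (v : BoundedContinuousFunction Plane ℝ) : 𝓓'(Ω, ℝ) :=
  let A : 𝓓(Ω, ℝ) →L[ℝ] ℝ :=
    (entryIntegralCLM Ω Dg v (1, 0)).comp
      ((TestFunction.toBoundedContinuousFunctionCLM ℝ).comp
        (TestFunction.lineDerivCLM ℝ (EuclideanSpace.single 1 1) : 𝓓(Ω, ℝ) →L[ℝ] 𝓓(Ω, ℝ)))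
    - (entryIntegralCLM Ω Dg v (1, 1)).comp
      ((TestFunction.toBoundedContinuousFunctionCLM ℝ).comp
        (TestFunction.lineDerivCLM ℝ (EuclideanSpace.single 0 1) : 𝓓(Ω, ℝ) →L[ℝ] 𝓓(Ω, ℝ)))
  { toFun := A
    map_add' := A.map_add
    map_smul' := A.map_smul
    cont := A.continuous }

theorem jacobianDistribution_apply (Ω : Opens Plane) (Dg : VectorMeasure Plane PlaneMatrix)
    (v : BoundedContinuousFunction Plane ℝ) (φ : 𝓓(Ω, ℝ)) :
    jacobianDistribution Ω Dg v φ
      = (∫ᵛ x in (Ω : Set Plane), v x * pderiv 1 φ x ∂•Dg) (1, 0)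
        - (∫ᵛ x in (Ω : Set Plane), v x * pderiv 0 φ x ∂•Dg) (1, 1) := by
  have hl (i : Fin 2) (x : Plane) : (TestFunction.lineDerivCLM ℝ (EuclideanSpace.single i 1) φ :
      𝓓(Ω, ℝ)) x = pderiv i φ x := by
    rw [TestFunction.lineDerivCLM_eq_fderivCLM, TestFunction.fderivCLM_apply_of_le _ (by simp)]
    rfl
  change (∫ᵛ x in (Ω : Set Plane), v x * (TestFunction.lineDerivCLM ℝ
      (EuclideanSpace.single 1 1) φ : 𝓓(Ω, ℝ)) x ∂•Dg) (1, 0)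
    - (∫ᵛ x in (Ω : Set Plane), v x * (TestFunction.lineDerivCLM ℝ
      (EuclideanSpace.single 0 1) φ : 𝓓(Ω, ℝ)) x ∂•Dg) (1, 1) = _
  simp only [hl]

theorem TestFunction.exists_pderiv_bound {Ω : Opens Plane} (φ : 𝓓(Ω, ℝ)) :
    ∃ M : ℝ, 0 ≤ M ∧ ∀ i x, |pderiv i φ x| ≤ M := by
  have h (i : Fin 2) : ∃ C, ∀ x, ‖pderiv i φ x‖ ≤ C :=
    (φ.contDiff.continuous_pderiv (by simp) i).bounded_above_of_compact_support
      (φ.hasCompactSupport.pderiv i)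
  choose C hC using h
  refine ⟨max (C 0) (C 1), ?_, fun i x => ?_⟩
  · exact ((norm_nonneg _).trans (hC 0 0)).trans (le_max_left _ _)
  · fin_cases i
    · exact (hC 0 x).trans (le_max_left _ _)
    · exact (hC 1 x).trans (le_max_right _ _)

section Jacobian

variable {η : Plane → ℝ} (hη : IsMollifier η) {f g : Plane → Plane} (hf : Continuous f)
  (hfu : UniformContinuous f) {Ω : Opens Plane} (hfg : ∀ x ∈ Ω, f x = g x)
  {Dg : VectorMeasure Plane PlaneMatrix} (hDg : IsDistribDeriv Ω g Dg)

/-- The support of a test function keeps a positive distance from the boundary of the domain. -/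
theorem TestFunction.exists_closedBall_subset {Ω : Opens Plane} (φ : 𝓓(Ω, ℝ)) :
    ∃ δ > 0, ∀ x ∈ tsupport φ, Metric.closedBall x δ ⊆ Ω := by
  obtain ⟨δ, hδ, h⟩ := φ.hasCompactSupport.isCompact.exists_cthickening_subset_open Ω.isOpen
    φ.tsupport_subset
  exact ⟨δ, hδ, fun x hx => (Metric.closedBall_subset_cthickening hx δ).trans h⟩

include hη hfg in
/-- In the definition of the distributional Jacobian, the map on `Ω` may be replaced by a
continuous extension to the plane. -/
theorem eventually_setIntegral_mul_det_mollify_eq (φ : 𝓓(Ω, ℝ)) :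
    ∀ᶠ ε in 𝓝[>] (0 : ℝ), ∫ x in (Ω : Set Plane), φ x * (fderiv ℝ (mollify η ε Ω g) x).det
      = ∫ x, φ x * (fderiv ℝ (mollify η ε ⊤ f) x).det := by
  obtain ⟨δ, hδ, hball⟩ := TestFunction.exists_closedBall_subset φ
  filter_upwards [Ioo_mem_nhdsGT hδ] with ε hε
  have h1 (x : Plane) : φ x * (fderiv ℝ (mollify η ε Ω g) x).det
      = φ x * (fderiv ℝ (mollify η ε ⊤ f) x).det := by
    by_cases hx : x ∈ tsupport φ
    · have : mollify η ε Ω g =ᶠ[𝓝 x] mollify η ε ⊤ f := by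
        filter_upwards [Metric.ball_mem_nhds x (sub_pos.2 hε.2)] with z hz
        refine mollify_eq_mollify_top hη hε.1 hfg
          ((Metric.closedBall_subset_closedBall' ?_).trans (hball x hx))
        rw [Metric.mem_ball] at hz
        linarith
      rw [this.fderiv_eq]
    · rw [image_eq_zero_of_notMem_tsupport hx, zero_mul, zero_mul]
  simp_rw [h1]
  refine setIntegral_eq_integral_of_forall_compl_eq_zero fun x hx => ?_
  rw [image_eq_zero_of_notMem_tsupport fun h => hx (φ.tsupport_subset h), zero_mul]

theorem bracket_eq_pderiv_sub {φ G : Plane → ℝ} (hφ : ContDiff ℝ ∞ φ) (hG : ContDiff ℝ ∞ G)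
    (x : Plane) : bracket φ G x
      = pderiv 1 (fun x => G x * pderiv 0 φ x) x - pderiv 0 (fun x => G x * pderiv 1 φ x) x := by
  rw [bracket_swap, bracket_eq_div (contDiff_infty.1 hG 1) (contDiff_infty.1 hφ 2)]
  ring

include hf hfg hDg in
/-- The definition of `Dg`, tested with `G dφ`. -/
theorem integral_coord_mul_bracket {G : Plane → ℝ} (hG : ContDiff ℝ ∞ G) (φ : 𝓓(Ω, ℝ)) :
    ∫ x, f x 1 * bracket φ G x = (∫ᵛ x in (Ω : Set Plane), G x * pderiv 1 φ x ∂•Dg) (1, 0)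
        - (∫ᵛ x in (Ω : Set Plane), G x * pderiv 0 φ x ∂•Dg) (1, 1) := by
  have hφ : ContDiff ℝ ∞ φ := φ.contDiff
  have hsm (i : Fin 2) : ContDiff ℝ ∞ fun x => G x * pderiv i φ x := hG.mul (hφ.pderiv_infty i)
  have hcs (i : Fin 2) : HasCompactSupport fun x => G x * pderiv i φ x :=
    (φ.hasCompactSupport.pderiv i).mul_left
  have hts (i : Fin 2) : tsupport (fun x => G x * pderiv i φ x) ⊆ Ω :=
    (tsupport_mul_subset_right.trans (tsupport_pderiv_subset _ i)).trans φ.tsupport_subset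
  let ψ (i : Fin 2) : 𝓓(Ω, ℝ) := ⟨fun x => G x * pderiv i φ x, hsm i, hcs i, hts i⟩
  have hfj : Continuous fun x => f x 1 := by fun_prop
  have key (i k : Fin 2) : ∫ x, f x 1 * pderiv k (fun x => G x * pderiv i φ x) x
      = -(∫ᵛ x in (Ω : Set Plane), G x * pderiv i φ x ∂•Dg) (1, k) := by
    rw [← setIntegral_eq_integral_of_forall_compl_eq_zero (s := (Ω : Set Plane)) fun x hx => by
      rw [image_eq_zero_of_notMem_tsupport fun h => hx (hts i (tsupport_pderiv_subset _ k h)),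
        mul_zero]]
    refine Eq.trans (setIntegral_congr_fun Ω.isOpen.measurableSet fun x hx => ?_) (hDg (ψ i) k 1)
    simp only [hfg x hx]
    rfl
  have hint (i k : Fin 2) : Integrable fun x => f x 1 * pderiv k (fun x => G x * pderiv i φ x) x :=
    (hfj.mul ((hsm i).continuous_pderiv (by simp) k)).integrable_of_hasCompactSupport
      ((hcs i).pderiv k).mul_left
  simp_rw [bracket_eq_pderiv_sub hφ hG, mul_sub]
  rw [integral_sub (hint 0 1) (hint 1 0), key, key]
  ring

include hη hf hfg hDg in
theorem integral_abs_bracket_mollify_le (φ : 𝓓(Ω, ℝ)) {M ε δ : ℝ} (hM : ∀ i x, |pderiv i φ x| ≤ M)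
    (hδ : ∀ x ∈ tsupport φ, Metric.closedBall x δ ⊆ Ω) (hε : 0 < ε) (hεδ : ε ≤ δ) (j : Fin 2) :
    ∫ x, |bracket φ (fun x => mollify η ε ⊤ f x j) x| ≤ 2 * M * (Dg.variation Ω).toReal := by
  have := isFiniteMeasure_variation Dg
  have hM0 : 0 ≤ M := (abs_nonneg _).trans (hM 0 0)
  have hh : ContDiff ℝ ∞ fun x => mollify η ε ⊤ f x j := contDiff_coord (contDiff_mollify hη hf hε) j
  set A := tsupport φ with hA
  have hAm : MeasurableSet A := (isClosed_tsupport _).measurableSet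
  have hp (i : Fin 2) : ∫⁻ x in A, ‖pderiv i (fun x => mollify η ε ⊤ f x j) x‖ₑ ≤ Dg.variation Ω :=
    lintegral_pderiv_mollify_le hη hf hfg hDg hε hAm Ω.isOpen.measurableSet subset_rfl
      (fun x hx => (Metric.closedBall_subset_closedBall hεδ).trans (hδ x hx)) i j
  have hφ0 {x : Plane} (hx : x ∉ A) (i : Fin 2) : pderiv i φ x = 0 :=
    image_eq_zero_of_notMem_tsupport fun h => hx (tsupport_pderiv_subset _ i h)
  have hpi (i : Fin 2) : IntegrableOn (pderiv i fun x => mollify η ε ⊤ f x j) A :=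
    ((hh.continuous_pderiv (by simp) i).continuousOn).integrableOn_compact φ.hasCompactSupport
  have hp' (i : Fin 2) : ∫ x in A, |pderiv i (fun x => mollify η ε ⊤ f x j) x|
      ≤ (Dg.variation Ω).toReal := by
    have h1 := (ofReal_integral_norm_eq_lintegral_enorm (hpi i)).trans_le (hp i)
    exact (ENNReal.ofReal_le_iff_le_toReal (measure_ne_top _ _)).1 h1
  have hle (x : Plane) (hx : x ∈ A) : |bracket φ (fun x => mollify η ε ⊤ f x j) x|
      ≤ M * |pderiv 1 (fun x => mollify η ε ⊤ f x j) x|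
        + M * |pderiv 0 (fun x => mollify η ε ⊤ f x j) x| := by
    refine (abs_sub _ _).trans ?_
    rw [abs_mul, abs_mul]
    gcongr
    · exact hM 0 x
    · exact hM 1 x
  rw [← setIntegral_eq_integral_of_forall_compl_eq_zero (s := A) fun x hx => by
    simp [bracket, hφ0 hx]]
  have hb : IntegrableOn (fun x => |bracket φ (fun x => mollify η ε ⊤ f x j) x|) A :=
    ((continuous_bracket φ.contDiff hh (by simp) (by simp)).abs.continuousOn).integrableOn_compact
      φ.hasCompactSupport
  refine (setIntegral_mono_on hb (((hpi 1).abs.const_mul M).add ((hpi 0).abs.const_mul M)) hAm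
    hle).trans ?_
  have hadd := integral_add ((hpi 1).abs.const_mul M) ((hpi 0).abs.const_mul M)
  refine hadd.trans_le ?_
  rw [integral_const_mul, integral_const_mul]
  nlinarith [hp' 0, hp' 1]

include hη hf hfu hfg hDg in
/-- The distribution `- g₀ dφ ∧ Dg₁` is the limit of the Jacobians of the mollifications. -/
theorem isDistribJacobian_tendsto (v : BoundedContinuousFunction Plane ℝ) (hv : ∀ x, v x = f x 0)
    (φ : 𝓓(Ω, ℝ)) :
    Tendsto (fun ε : ℝ => ∫ x, φ x * (fderiv ℝ (mollify η ε ⊤ f) x).det) (𝓝[>] 0)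
      (𝓝 (jacobianDistribution Ω Dg v φ)) := by
  obtain ⟨δ, hδ, hball⟩ := TestFunction.exists_closedBall_subset φ
  obtain ⟨M, hM0, hM⟩ := TestFunction.exists_pderiv_bound φ
  set V := (Dg.variation Ω).toReal with hV
  have hV0 : 0 ≤ V := ENNReal.toReal_nonneg
  have hφ : ContDiff ℝ ∞ φ := φ.contDiff
  have hφ1 : ContDiff ℝ 1 φ := contDiff_infty.1 hφ 1
  rw [Metric.tendsto_nhds]
  intro e he
  obtain ⟨κ, hκ, hκe⟩ : ∃ κ > 0, 6 * κ * M * V < e / 2 := by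
    refine ⟨e / (2 * (6 * M * V + 1)), by positivity, ?_⟩
    have hc : 0 < 6 * M * V + 1 := by positivity
    rw [show 6 * (e / (2 * (6 * M * V + 1))) * M * V = e / 2 * ((6 * M * V) / (6 * M * V + 1)) by
      field_simp]
    exact mul_lt_of_lt_one_right (half_pos he) ((div_lt_one hc).2 (by linarith))
  -- a smooth approximation `G` of `f₀`
  obtain ⟨ε₀, hε₀, hε₀0⟩ := ((eventually_dist_mollify_le hη hf hfu hκ).and
    self_mem_nhdsWithin).exists
  set G : Plane → ℝ := fun x => mollify η ε₀ ⊤ f x 0 with hGdef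
  have hG : ContDiff ℝ ∞ G := contDiff_coord (contDiff_mollify hη hf hε₀0) 0
  have hcoord {a b : Plane} {s : ℝ} (h : dist a b ≤ s) (j : Fin 2) : |a j - b j| ≤ s := by
    rw [dist_eq_norm] at h
    exact (PiLp.norm_apply_le (a - b) j).trans h
  have hGv (x : Plane) : |G x - v x| ≤ κ := by rw [hv]; exact hcoord (hε₀ x) 0
  have hbGc : HasCompactSupport (bracket φ G) := hasCompactSupport_bracket φ.hasCompactSupport G
  have hbG : Continuous (bracket φ G) := continuous_bracket hφ hG (by simp) (by simp)
  set N := ∫ x, |bracket φ G x| with hN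
  have hN0 : 0 ≤ N := integral_nonneg fun x => abs_nonneg _
  obtain ⟨κ', hκ', hκ'e⟩ : ∃ κ' > 0, κ' * N < e / 2 := by
    refine ⟨e / (2 * (N + 1)), by positivity, ?_⟩
    rw [show e / (2 * (N + 1)) * N = e / 2 * (N / (N + 1)) by field_simp]
    exact mul_lt_of_lt_one_right (half_pos he) ((div_lt_one (by positivity)).2 (by linarith))
  -- the error of replacing `f₀` by `G` in the distribution
  set T := ∫ x, f x 1 * bracket φ G x with hT
  have hTJ : |T - jacobianDistribution Ω Dg v φ| ≤ 2 * κ * M * V := by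
    have hsub (i : Fin 2) (p) : |(∫ᵛ x in (Ω : Set Plane), G x * pderiv i φ x ∂•Dg) p
        - (∫ᵛ x in (Ω : Set Plane), v x * pderiv i φ x ∂•Dg) p| ≤ κ * M * V := by
      have hpc : Continuous (pderiv i φ) := hφ.continuous_pderiv (by simp) i
      have hint (u : Plane → ℝ) (hu : Continuous u) :
          (Dg.restrict (Ω : Set Plane)).Integrable fun x => u x * pderiv i φ x := by
        obtain ⟨C, hC⟩ := (hu.mul hpc).bounded_above_of_compact_support
          ((φ.hasCompactSupport.pderiv i).mul_left)
        exact integrable_restrict_variation (hu.mul hpc) hC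
      have h1 := VectorMeasure.integral_fun_sub (B := ContinuousLinearMap.lsmul ℝ ℝ)
        (hint G hG.continuous) (hint v v.continuous)
      have h2 := congrArg (fun w : PlaneMatrix => w p) h1
      simp only [PiLp.sub_apply] at h2
      rw [← h2]
      refine abs_vectorIntegral_le (fun x => ?_) p
      rw [← sub_mul, abs_mul]
      exact mul_le_mul (hGv x) (hM i x) (abs_nonneg _) hκ.le
    rw [hT, integral_coord_mul_bracket hf hfg hDg hG φ, jacobianDistribution_apply]
    have ha := hsub 1 (1, 0)
    have hb := hsub 0 (1, 1)
    rw [abs_le] at ha hb ⊢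
    constructor <;> linarith [ha.1, ha.2, hb.1, hb.2]
  filter_upwards [eventually_dist_mollify_le hη hf hfu hκ,
    eventually_dist_mollify_le hη hf hfu hκ', Ioo_mem_nhdsGT hδ] with ε hcl hcl' hε
  have hh : ContDiff ℝ ∞ (mollify η ε ⊤ f) := contDiff_mollify hη hf hε.1
  have hc (j : Fin 2) : ContDiff ℝ ∞ fun x => mollify η ε ⊤ f x j := contDiff_coord hh j
  set h₀ : Plane → ℝ := fun x => mollify η ε ⊤ f x 0 with hh₀
  set h₁ : Plane → ℝ := fun x => mollify η ε ⊤ f x 1 with hh₁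
  have hc0 : ContDiff ℝ ∞ h₀ := hc 0
  have hc1 : ContDiff ℝ ∞ h₁ := hc 1
  have hb1 : Continuous (bracket φ h₁) := continuous_bracket hφ hc1 (by simp) (by simp)
  have hb1c : HasCompactSupport (bracket φ h₁) := hasCompactSupport_bracket φ.hasCompactSupport h₁
  have e1 : ∫ x, φ x * (fderiv ℝ (mollify η ε ⊤ f) x).det = -∫ x, h₀ x * bracket φ h₁ x := by
    rw [← integral_mul_bracket hφ1 φ.hasCompactSupport (contDiff_infty.1 hc0 1)
      (contDiff_infty.1 hc1 2)]
    congr with x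
    rw [det_eq_bracket (hh.differentiable (by simp) x)]
  have e2 : ∫ x, G x * bracket φ h₁ x = -∫ x, h₁ x * bracket φ G x := by
    have i1 := integral_mul_bracket hφ1 φ.hasCompactSupport (contDiff_infty.1 hG 1)
      (contDiff_infty.1 hc1 2)
    have i2 := integral_mul_bracket hφ1 φ.hasCompactSupport (contDiff_infty.1 hc1 1)
      (contDiff_infty.1 hG 2)
    simp_rw [bracket_swap G h₁, mul_neg, integral_neg] at i2
    change (∫ x, φ x * bracket G h₁ x) = _ at i1
    linarith
  -- uniform estimates for products
  have hest {a b w : Plane → ℝ} {s : ℝ} (ha : Continuous a) (hb : Continuous b)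
      (hw : Continuous w) (hwc : HasCompactSupport w) (hs : ∀ x, |a x - b x| ≤ s) :
      |(∫ x, a x * w x) - ∫ x, b x * w x| ≤ s * ∫ x, |w x| := by
    have hia : Integrable fun x => a x * w x :=
      (ha.mul hw).integrable_of_hasCompactSupport hwc.mul_left
    have hib : Integrable fun x => b x * w x :=
      (hb.mul hw).integrable_of_hasCompactSupport hwc.mul_left
    have hiw := hw.integrable_of_hasCompactSupport hwc (μ := volume)
    rw [← integral_sub hia hib, ← integral_const_mul]
    refine (abs_integral_le_integral_abs).trans (integral_mono (hia.sub hib).abs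
      (hiw.abs.const_mul s) fun x => ?_)
    simp only [← sub_mul, abs_mul]
    exact mul_le_mul_of_nonneg_right (hs x) (abs_nonneg _)
  have hb1le : ∫ x, |bracket φ h₁ x| ≤ 2 * M * V :=
    integral_abs_bracket_mollify_le hη hf hfg hDg φ hM hball hε.1 hε.2.le 1
  have f1 : |(∫ x, h₀ x * bracket φ h₁ x) - ∫ x, G x * bracket φ h₁ x| ≤ 2 * κ * (2 * M * V) := by
    refine (hest (s := 2 * κ) hc0.continuous hG.continuous hb1 hb1c fun x => ?_).trans ?_
    · have h1 := hcoord (hcl x) 0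
      have h2 := hcoord (hε₀ x) 0
      rw [abs_le] at h1 h2 ⊢
      simp only [hGdef, hh₀]
      constructor <;> linarith [h1.1, h1.2, h2.1, h2.2]
    · gcongr
  have f2 : |(∫ x, h₁ x * bracket φ G x) - T| ≤ κ' * N :=
    hest hc1.continuous (by fun_prop) hbG hbGc fun x => hcoord (hcl' x) 1
  rw [Real.dist_eq, e1]
  rw [abs_le] at f1 f2 hTJ
  rw [abs_lt]
  constructor <;> nlinarith [f1.1, f1.2, f2.1, f2.2, hTJ.1, hTJ.2]

include hf hfu hfg hDg in
theorem isDistribJacobian_jacobianDistribution (v : BoundedContinuousFunction Plane ℝ)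
    (hv : ∀ x, v x = f x 0) : IsDistribJacobian Ω g (jacobianDistribution Ω Dg v) :=
  fun _ hη φ => (isDistribJacobian_tendsto hη hf hfu hfg hDg v hv φ).congr'
    ((eventually_setIntegral_mul_det_mollify_eq hη hfg φ).mono fun _ h => h.symm)

end Jacobian

/-! ### The smoothed push-forward of a weighted Jacobian -/

/-- The push-forward under `h` of the signed measure `φ det ∇h dx`, smoothed with the kernel of
radius `δ`. Where `φ = 1` on the relevant part of the domain it is the degree of `h`. -/
noncomputable def pushforwardDensity (η : Plane → ℝ) (δ : ℝ) (φ : Plane → ℝ) (h : Plane → Plane)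
    (y : Plane) : ℝ := ∫ x, φ x * (kernel η δ (h x - y) * (fderiv ℝ h x).det)

theorem norm_clm_plane_le (L : Plane →L[ℝ] ℝ) :
    ‖L‖ ≤ |L (EuclideanSpace.single 0 1)| + |L (EuclideanSpace.single 1 1)| := by
  refine L.opNorm_le_bound (by positivity) fun v => ?_
  rw [clm_plane_apply L v, add_mul]
  refine (abs_add_le _ _).trans (add_le_add ?_ ?_) <;>
  · rw [abs_mul]
    exact mul_le_mul_of_nonneg_left (PiLp.norm_apply_le v _) (abs_nonneg _)

section Pushforward

variable {η : Plane → ℝ} (hη : IsMollifier η) {δ : ℝ} (hδ : 0 < δ) {φ : Plane → ℝ}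
  (hφ : ContDiff ℝ ∞ φ) (hc : HasCompactSupport φ) {h : Plane → Plane} (hh : ContDiff ℝ ∞ h)

include hη hδ

theorem pushforwardDensity_eq_zero {R : ℝ} (hR : ∀ x ∈ tsupport φ, ‖h x‖ ≤ R) {y : Plane}
    (hy : R + δ < ‖y‖) : pushforwardDensity η δ φ h y = 0 := by
  refine integral_eq_zero_of_ae (Eventually.of_forall fun x => ?_)
  by_cases hx : x ∈ tsupport φ
  · have h1 : δ < ‖h x - y‖ := by
      have := norm_sub_norm_le y (h x)
      rw [norm_sub_rev] at this
      linarith [hR x hx]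
    simp [hη.kernel_eq_zero hδ h1]
  · simp [image_eq_zero_of_notMem_tsupport hx]

include hc hh

theorem hasCompactSupport_pushforwardDensity :
    HasCompactSupport (pushforwardDensity η δ φ h) := by
  obtain ⟨R, hR⟩ := hc.isCompact.exists_bound_of_continuousOn hh.continuous.continuousOn
  refine HasCompactSupport.intro (isCompact_closedBall (0 : Plane) (R + δ)) fun y hy => ?_
  refine pushforwardDensity_eq_zero hη hδ hR ?_
  simpa using hy

include hφ

theorem hasFDerivAt_pushforwardDensity (y : Plane) :
    HasFDerivAt (pushforwardDensity η δ φ h)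
      (∫ x, -((φ x * (fderiv ℝ h x).det) • fderiv ℝ (kernel η δ) (h x - y))) y ∧
    Continuous fun y => ∫ x, -((φ x * (fderiv ℝ h x).det) • fderiv ℝ (kernel η δ) (h x - y)) := by
  have hk := hη.contDiff_kernel δ
  have hkc := hη.hasCompactSupport_kernel hδ
  have hdk : Continuous (fderiv ℝ (kernel η δ)) := hk.continuous_fderiv (by simp)
  obtain ⟨C, hC⟩ := hdk.bounded_above_of_compact_support (hkc.fderiv (𝕜 := ℝ))
  set a : Plane → ℝ := fun x => φ x * (fderiv ℝ h x).det with ha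
  have hac : Continuous a := hφ.continuous.mul (continuous_det_fderiv hh)
  have haS : HasCompactSupport a := hc.mul_right
  have hbint : Integrable fun x => |a x| * C :=
    ((hac.integrable_of_hasCompactSupport haS).abs).mul_const C
  have hF' (y : Plane) : Continuous fun x => -(a x • fderiv ℝ (kernel η δ) (h x - y)) :=
    (hac.smul (hdk.comp (hh.continuous.sub continuous_const))).neg
  have hbd (x y : Plane) : ‖-(a x • fderiv ℝ (kernel η δ) (h x - y))‖ ≤ |a x| * C := by
    rw [norm_neg, norm_smul]
    exact mul_le_mul_of_nonneg_left (hC _) (abs_nonneg _)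
  have hF (y : Plane) : Continuous fun x => φ x * (kernel η δ (h x - y) * (fderiv ℝ h x).det) :=
    hφ.continuous.mul ((hk.continuous.comp (hh.continuous.sub continuous_const)).mul
      (continuous_det_fderiv hh))
  constructor
  · refine hasFDerivAt_integral_of_dominated_of_fderiv_le (s := univ) (bound := fun x => |a x| * C)
      (F := fun y x => φ x * (kernel η δ (h x - y) * (fderiv ℝ h x).det)) univ_mem
      (Eventually.of_forall fun y => (hF y).aestronglyMeasurable)
      ((hF y).integrable_of_hasCompactSupport hc.mul_right) (hF' y).aestronglyMeasurable
      (Eventually.of_forall fun x y _ => hbd x y) hbint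
      (Eventually.of_forall fun x y _ => ?_)
    have h1 : HasFDerivAt (fun y => h x - y) (-ContinuousLinearMap.id ℝ Plane) y :=
      (hasFDerivAt_id y).const_sub (h x)
    have h2 : HasFDerivAt (fun y => kernel η δ (h x - y)) _ y :=
      (hk.differentiable (by simp) (h x - y)).hasFDerivAt.comp y h1
    convert! (h2.const_mul (a x)) using 1
    · ext y; simp only [ha]; ring
    · ext v; simp
  · refine continuous_of_dominated (fun y => (hF' y).aestronglyMeasurable)
      (fun y => Eventually.of_forall fun x => hbd x y) hbint (Eventually.of_forall fun x => ?_)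
    have hcx : Continuous fun y => fderiv ℝ (kernel η δ) (h x - y) :=
      hdk.comp (continuous_const.sub continuous_id)
    exact (hcx.const_smul (a x)).neg

theorem contDiff_pushforwardDensity : ContDiff ℝ 1 (pushforwardDensity η δ φ h) := by
  rw [contDiff_one_iff_fderiv]
  refine ⟨fun y => (hasFDerivAt_pushforwardDensity hη hδ hφ hc hh y).1.differentiableAt, ?_⟩
  have : fderiv ℝ (pushforwardDensity η δ φ h) = fun y =>
      ∫ x, -((φ x * (fderiv ℝ h x).det) • fderiv ℝ (kernel η δ) (h x - y)) := by
    ext1 y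
    exact (hasFDerivAt_pushforwardDensity hη hδ hφ hc hh y).1.fderiv
  rw [this]
  exact (hasFDerivAt_pushforwardDensity hη hδ hφ hc hh 0).2

theorem pderiv_pushforwardDensity (i : Fin 2) (y : Plane) :
    pderiv i (pushforwardDensity η δ φ h) y
      = -∫ x, φ x * (pderiv i (fun v => kernel η δ (v - y)) (h x) * (fderiv ℝ h x).det) := by
  have hk := hη.contDiff_kernel δ
  have hdk : Continuous (fderiv ℝ (kernel η δ)) := hk.continuous_fderiv (by simp)
  have hi : Integrable fun x => -((φ x * (fderiv ℝ h x).det) • fderiv ℝ (kernel η δ) (h x - y)) :=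
    Continuous.integrable_of_hasCompactSupport
      ((hφ.continuous.mul (continuous_det_fderiv hh)).smul
        (hdk.comp (hh.continuous.sub continuous_const))).neg
      ((hc.mul_right).smul_right).neg
  rw [pderiv, (hasFDerivAt_pushforwardDensity hη hδ hφ hc hh y).1.fderiv,
    ContinuousLinearMap.integral_apply hi, ← integral_neg]
  congr with x
  have h1 : HasFDerivAt (fun v : Plane => v - y) (ContinuousLinearMap.id ℝ Plane) (h x) :=
    (hasFDerivAt_id (h x)).sub_const y
  have h2 : HasFDerivAt (fun v => kernel η δ (v - y)) _ (h x) :=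
    HasFDerivAt.comp (g := kernel η δ) (h x)
      (hk.differentiable (by simp) (h x - y)).hasFDerivAt h1
  rw [pderiv, h2.fderiv]
  simp
  ring

/-- By Stokes' formula, the derivatives of the smoothed push-forward only involve `dφ`. -/
theorem lintegral_pderiv_pushforwardDensity_le (i : Fin 2) :
    ∫⁻ y, ‖pderiv i (pushforwardDensity η δ φ h) y‖ₑ
      ≤ ∫⁻ x, ‖bracket φ (fun x => h x (1 - i)) x‖ₑ := by
  have hk := hη.contDiff_kernel δ
  have hW (y : Plane) : ContDiff ℝ 1 fun v => kernel η δ (v - y) :=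
    contDiff_infty.1 (hk.comp (contDiff_id.sub contDiff_const)) 1
  have hb : Continuous (bracket φ fun x => h x (1 - i)) :=
    continuous_bracket hφ (contDiff_coord hh _) (by simp) (by simp)
  have hstokes (y : Plane) : ‖pderiv i (pushforwardDensity η δ φ h) y‖ₑ
      ≤ ∫⁻ x, ‖kernel η δ (h x - y) * bracket φ (fun x => h x (1 - i)) x‖ₑ := by
    refine le_trans (le_of_eq ?_) (enorm_integral_le_lintegral_enorm _)
    rw [pderiv_pushforwardDensity hη hδ hφ hc hh, enorm_neg]
    fin_cases i
    · change ‖∫ x, φ x * (pderiv 0 (fun v => kernel η δ (v - y)) (h x) * (fderiv ℝ h x).det)‖ₑ = _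
      rw [integral_mul_pderiv_zero_comp (hW y) hh (contDiff_infty.1 hφ 1) hc, enorm_neg]
      rfl
    · change ‖∫ x, φ x * (pderiv 1 (fun v => kernel η δ (v - y)) (h x) * (fderiv ℝ h x).det)‖ₑ = _
      rw [integral_mul_pderiv_one_comp (hW y) hh (contDiff_infty.1 hφ 1) hc]
      rfl
  have hm : Measurable fun p : Plane × Plane =>
      ‖kernel η δ (h p.2 - p.1) * bracket φ (fun x => h x (1 - i)) p.2‖ₑ :=
    ((hk.continuous.comp ((hh.continuous.comp continuous_snd).sub continuous_fst)).mul
      (hb.comp continuous_snd)).measurable.enorm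
  refine (lintegral_mono hstokes).trans ?_
  rw [lintegral_lintegral_swap hm.aemeasurable]
  refine lintegral_mono fun x => ?_
  simp_rw [enorm_mul]
  have hkm : Measurable fun y => ‖kernel η δ (h x - y)‖ₑ :=
    (hk.continuous.comp (continuous_const.sub continuous_id)).measurable.enorm
  rw [lintegral_mul_const _ hkm,
    lintegral_sub_left_eq_self (fun v => ‖kernel η δ v‖ₑ) (h x)]
  have h2 : Integrable (kernel η δ) := integrable_of_integral_eq_one (hη.integral_kernel hδ)
  rw [← ofReal_integral_norm_eq_lintegral_enorm h2]
  simp_rw [Real.norm_of_nonneg (hη.kernel_nonneg δ _)]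
  simp [hη.integral_kernel hδ]

/-- The Gagliardo–Nirenberg–Sobolev inequality bounds the smoothed push-forward in `L²`. -/
theorem eLpNorm_pushforwardDensity_le :
    eLpNorm (pushforwardDensity η δ φ h) 2 volume
      ≤ eLpNormLESNormFDerivOneConst (volume : Measure Plane) (2 : NNReal) *
        ((∫⁻ x, ‖bracket φ (fun x => h x 1) x‖ₑ) + ∫⁻ x, ‖bracket φ (fun x => h x 0) x‖ₑ) := by
  have hu := contDiff_pushforwardDensity hη hδ hφ hc hh
  have hp : NNReal.HolderConjugate (Module.finrank ℝ Plane) 2 := by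
    rw [finrank_euclideanSpace_fin]
    exact_mod_cast NNReal.HolderConjugate.two_two
  have h1 := eLpNorm_le_eLpNorm_fderiv_one (volume : Measure Plane) hu
    (hasCompactSupport_pushforwardDensity hη hδ hc hh) hp
  rw [ENNReal.coe_ofNat] at h1
  refine h1.trans (mul_le_mul' le_rfl ?_)
  rw [eLpNorm_one_eq_lintegral_enorm]
  calc ∫⁻ y, ‖fderiv ℝ (pushforwardDensity η δ φ h) y‖ₑ
      ≤ ∫⁻ y, (‖pderiv 0 (pushforwardDensity η δ φ h) y‖ₑ
          + ‖pderiv 1 (pushforwardDensity η δ φ h) y‖ₑ) := by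
        refine lintegral_mono fun y => ?_
        rw [← ofReal_norm, ← ofReal_norm, ← ofReal_norm, ← ENNReal.ofReal_add (norm_nonneg _)
          (norm_nonneg _)]
        exact ENNReal.ofReal_le_ofReal (norm_clm_plane_le _)
    _ = (∫⁻ y, ‖pderiv 0 (pushforwardDensity η δ φ h) y‖ₑ)
          + ∫⁻ y, ‖pderiv 1 (pushforwardDensity η δ φ h) y‖ₑ :=
        lintegral_add_left (hu.continuous_pderiv one_ne_zero 0).measurable.enorm _
    _ ≤ _ := by
        have h0 := lintegral_pderiv_pushforwardDensity_le hη hδ hφ hc hh 0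
        have h1 := lintegral_pderiv_pushforwardDensity_le hη hδ hφ hc hh 1
        rw [sub_zero] at h0
        rw [sub_self] at h1
        exact add_le_add h0 h1

theorem integral_pushforwardDensity :
    ∫ y, pushforwardDensity η δ φ h y = ∫ x, φ x * (fderiv ℝ h x).det := by
  have hk := hη.contDiff_kernel δ
  obtain ⟨R, hR⟩ := hc.isCompact.exists_bound_of_continuousOn hh.continuous.continuousOn
  have hcont : Continuous (Function.uncurry fun y x : Plane =>
      φ x * (kernel η δ (h x - y) * (fderiv ℝ h x).det)) := by
    have h1 := hφ.continuous; have h2 := hh.continuous; have h3 := hk.continuous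
    have h4 := continuous_det_fderiv hh
    exact (h1.comp continuous_snd).mul ((h3.comp ((h2.comp continuous_snd).sub
      continuous_fst)).mul (h4.comp continuous_snd))
  have hcs : HasCompactSupport (Function.uncurry fun y x : Plane =>
      φ x * (kernel η δ (h x - y) * (fderiv ℝ h x).det)) := by
    refine HasCompactSupport.intro
      ((isCompact_closedBall (0 : Plane) (R + δ)).prod hc.isCompact) ?_
    rintro ⟨y, x⟩ hyx
    by_cases hx : x ∈ tsupport φ
    · have hy : R + δ < ‖y‖ := by
        by_contra hy
        exact hyx ⟨by simpa using hy, hx⟩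
      have h1 : δ < ‖h x - y‖ := by
        have := norm_sub_norm_le y (h x)
        rw [norm_sub_rev] at this
        linarith [hR x hx]
      simp [Function.uncurry, hη.kernel_eq_zero hδ h1]
    · simp [Function.uncurry, image_eq_zero_of_notMem_tsupport hx]
  unfold pushforwardDensity
  rw [integral_integral_swap_of_hasCompactSupport hcont hcs]
  congr with x
  rw [integral_const_mul, integral_mul_const,
    integral_sub_left_eq_self (kernel η δ) volume (h x), hη.integral_kernel hδ, one_mul]

end Pushforward

/-! ### Convergence of integrals under an `L²` bound -/

/-- By Hölder's inequality, a family bounded in `L²` is uniformly integrable. -/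
theorem unifIntegrable_of_eLpNorm_two_le {α ι : Type*} [MeasurableSpace α] {μ : Measure α}
    {u : ι → α → ℝ} (hu : ∀ k, AEStronglyMeasurable (u k) μ) {K : ENNReal} (hK : K ≠ ⊤)
    (huK : ∀ k, eLpNorm (u k) 2 μ ≤ K) : UnifIntegrable u 1 μ := by
  intro ε hε
  set K' : ℝ := K.toReal + 1 with hK'
  have hK'0 : 0 < K' := by positivity
  refine ⟨(ε / K') ^ 2, by positivity, fun k s hs hμs => ?_⟩
  rw [eLpNorm_indicator_eq_eLpNorm_restrict hs]
  refine (eLpNorm_le_eLpNorm_mul_rpow_measure_univ (p := 1) (q := 2) (by norm_num)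
    (hu k).restrict).trans ?_
  have h1 : ((μ.restrict s) univ) ^ (1 / (1 : ENNReal).toReal - 1 / (2 : ENNReal).toReal)
      ≤ ENNReal.ofReal (ε / K') := by
    rw [Measure.restrict_apply_univ]
    have h2 : (1 / (1 : ENNReal).toReal - 1 / (2 : ENNReal).toReal) = (1 / 2 : ℝ) := by norm_num
    rw [h2]
    refine (ENNReal.rpow_le_rpow hμs (by norm_num)).trans (le_of_eq ?_)
    rw [ENNReal.ofReal_rpow_of_pos (by positivity), ← Real.sqrt_eq_rpow,
      Real.sqrt_sq (by positivity)]
  calc eLpNorm (u k) 2 (μ.restrict s) * _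
      ≤ ENNReal.ofReal K' * ENNReal.ofReal (ε / K') := by
        refine mul_le_mul' ((eLpNorm_mono_measure _ Measure.restrict_le_self).trans
          ((huK k).trans ?_)) h1
        rw [← ENNReal.ofReal_toReal hK]
        exact ENNReal.ofReal_le_ofReal (by simp [hK'])
    _ = ENNReal.ofReal ε := by
        rw [← ENNReal.ofReal_mul hK'0.le, mul_div_cancel₀ _ hK'0.ne']

/-- Vitali's theorem for sequences that are bounded in `L²` and live on a set of finite measure. -/
theorem integrable_and_tendsto_integral_of_eLpNorm_two_le {α : Type*} [MeasurableSpace α]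
    {μ : Measure α} {u : ℕ → α → ℝ} {v : α → ℝ} (hu : ∀ k, AEStronglyMeasurable (u k) μ)
    {K : ENNReal} (hK : K ≠ ⊤) (huK : ∀ k, eLpNorm (u k) 2 μ ≤ K) {B : Set α}
    (hB : MeasurableSet B) (hμB : μ B ≠ ⊤) (huB : ∀ k, ∀ y ∉ B, u k y = 0)
    (hlim : ∀ᵐ y ∂μ, Tendsto (fun k => u k y) atTop (𝓝 (v y))) :
    Integrable v μ ∧ Tendsto (fun k => ∫ y, u k y ∂μ) atTop (𝓝 (∫ y, v y ∂μ)) := by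
  have hvB : ∀ᵐ y ∂μ, y ∉ B → v y = 0 := by
    filter_upwards [hlim] with y hy hyB
    refine tendsto_nhds_unique hy ?_
    simp [huB _ y hyB]
  have : IsFiniteMeasure (μ.restrict B) := ⟨by simpa using hμB.lt_top⟩
  have hum (k) : AEStronglyMeasurable (u k) (μ.restrict B) := (hu k).restrict
  have huK' (k) : eLpNorm (u k) 2 (μ.restrict B) ≤ K :=
    (eLpNorm_mono_measure _ Measure.restrict_le_self).trans (huK k)
  have hlim' : ∀ᵐ y ∂μ.restrict B, Tendsto (fun k => u k y) atTop (𝓝 (v y)) :=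
    ae_restrict_of_ae hlim
  have hUI := unifIntegrable_of_eLpNorm_two_le hum hK huK'
  have hvm : AEStronglyMeasurable v (μ.restrict B) := aestronglyMeasurable_of_tendsto_ae _ hum hlim'
  have hbd (w : α → ℝ) (hw : AEStronglyMeasurable w (μ.restrict B))
      (hw2 : eLpNorm w 2 (μ.restrict B) ≤ K) : MemLp w 1 (μ.restrict B) :=
    MemLp.mono_exponent (q := 2) ⟨hw, hw2.trans_lt hK.lt_top⟩ (by norm_num)
  have hv2 : eLpNorm v 2 (μ.restrict B) ≤ K := by
    refine (Lp.eLpNorm_lim_le_liminf_eLpNorm hum v hlim').trans ?_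
    exact liminf_le_of_le (by isBoundedDefault) fun b hb => by
      obtain ⟨k, hk⟩ := hb.exists
      exact hk.trans (huK' k)
  have hv1 := hbd v hvm hv2
  have hL1 := tendsto_Lp_finite_of_tendsto_ae le_rfl ENNReal.one_ne_top hum hv1 hUI hlim'
  have hint := tendsto_integral_of_L1' v hvm
    (Eventually.of_forall fun k => memLp_one_iff_integrable.1 (hbd _ (hum k) (huK' k))) hL1
  have hvI : B.indicator v =ᵐ[μ] v := by
    filter_upwards [hvB] with y hy
    by_cases hyB : y ∈ B
    · simp [hyB]
    · simp [hyB, hy hyB]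
  refine ⟨((integrable_indicator_iff hB).2 (memLp_one_iff_integrable.1 hv1)).congr hvI, ?_⟩
  rw [← integral_congr_ae hvI, integral_indicator hB]
  refine hint.congr fun k => ?_
  exact setIntegral_eq_integral_of_forall_compl_eq_zero fun y hy => huB k y hy

/-! ### Geometry of squares -/

theorem mem_square {c x : Plane} {r : ℝ} : x ∈ square c r ↔ ∀ i, |x i - c i| < r := Iff.rfl

theorem measurableSet_square (c : Plane) (r : ℝ) : MeasurableSet (square c r : Set Plane) :=
  (square c r).isOpen.measurableSet

theorem isBounded_square (c : Plane) (r : ℝ) : Bornology.IsBounded (square c r : Set Plane) := by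
  refine Metric.isBounded_closedBall (x := c) (r := 2 * r) |>.subset fun x hx => ?_
  have hx' := mem_square.1 hx
  have h0 := hx' 0
  have h1 := hx' 1
  rw [Metric.mem_closedBall, EuclideanSpace.dist_eq, Fin.sum_univ_two, Real.dist_eq, Real.dist_eq]
  refine Real.sqrt_le_iff.2 ⟨by linarith [abs_nonneg (x 0 - c 0)], ?_⟩
  nlinarith [abs_nonneg (x 0 - c 0), abs_nonneg (x 1 - c 1)]

/-- A compact subset of the square lies in all slightly smaller concentric squares. -/
theorem IsCompact.exists_subset_square {c : Plane} {r : ℝ} {K : Set Plane} (hK : IsCompact K)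
    (hKr : K ⊆ square c r) : ∃ s < r, ∀ t, s < t → K ⊆ square c t := by
  obtain ⟨s, hs, H⟩ := hK.exists_forall_le' 
    (f := fun x : Plane => -max |x 0 - c 0| |x 1 - c 1|) (a := -r) (by fun_prop)
    fun x hx => neg_lt_neg (max_lt (mem_square.1 (hKr hx) 0) (mem_square.1 (hKr hx) 1))
  refine ⟨-s, by linarith, fun t hst x hx => mem_square.2 fun i => ?_⟩
  have := le_neg.1 (H x hx)
  fin_cases i
  · exact ((le_max_left _ _).trans this).trans_lt hst
  · exact ((le_max_right _ _).trans this).trans_lt hst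

theorem closedBall_subset_compl_square {c x : Plane} {s ε : ℝ} (hx : x ∉ square c s) :
    Metric.closedBall x ε ⊆ (square c (s - ε) : Set Plane)ᶜ := by
  intro z hz hzs
  refine hx (mem_square.2 fun i => ?_)
  have h1 := mem_square.1 hzs i
  have h2 : |x i - z i| ≤ ε := by
    rw [← Real.norm_eq_abs]
    refine (PiLp.norm_apply_le (x - z) i).trans ?_
    rwa [← dist_eq_norm, dist_comm]
  have h3 := abs_sub_le (x i) (z i) (c i)
  linarith

/-! ### Cut-off functions of the square -/

theorem exists_deriv_smoothTransition_le : ∃ L, ∀ t, |deriv Real.smoothTransition t| ≤ L := by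
  have hc : Continuous (deriv Real.smoothTransition) :=
    (Real.smoothTransition.contDiff (n := 1)).continuous_deriv le_rfl
  refine hc.bounded_above_of_compact_support (HasCompactSupport.intro (isCompact_Icc (a := 0)
    (b := 1)) fun t ht => ?_)
  rw [mem_Icc, not_and_or, not_le, not_le] at ht
  rcases ht with ht | ht
  · have : Real.smoothTransition =ᶠ[𝓝 t] fun _ => 0 := by
      filter_upwards [Iio_mem_nhds ht] with s hs
      exact Real.smoothTransition.zero_of_nonpos hs.le
    rw [this.deriv_eq, deriv_const]
  · have : Real.smoothTransition =ᶠ[𝓝 t] fun _ => 1 := by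
      filter_upwards [Ioi_mem_nhds ht] with s hs
      exact Real.smoothTransition.one_of_one_le hs.le
    rw [this.deriv_eq, deriv_const]

/-- A smooth profile that is `1` for `|t| < ρ`, is `0` for `b < |t|`, and has slope at most
`2 L / (b - ρ)`. -/
theorem exists_profile : ∃ L : ℝ, ∀ ρ b : ℝ, 0 < ρ → ρ < b → ∃ s : ℝ → ℝ, ContDiff ℝ ∞ s ∧
    (∀ t, s t ∈ Icc (0 : ℝ) 1) ∧ (∀ t, |t| < ρ → s t = 1) ∧ (∀ t, b < |t| → s t = 0) ∧
    ∀ t, |deriv s t| ≤ 2 * L / (b - ρ) := by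
  obtain ⟨L, hL⟩ := exists_deriv_smoothTransition_le
  refine ⟨L, fun ρ b hρ hb => ?_⟩
  have hd : 0 < b ^ 2 - ρ ^ 2 := by nlinarith
  have hL0 : 0 ≤ L := (abs_nonneg _).trans (hL 0)
  set q : ℝ → ℝ := fun t => (b ^ 2 - t ^ 2) / (b ^ 2 - ρ ^ 2) with hq
  have hsm : ContDiff ℝ ∞ (Real.smoothTransition ∘ q) :=
    Real.smoothTransition.contDiff.comp (by fun_prop)
  have hzero (t : ℝ) (ht : b < |t|) : (Real.smoothTransition ∘ q) t = 0 := by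
    refine Real.smoothTransition.zero_of_nonpos (div_nonpos_of_nonpos_of_nonneg ?_ hd.le)
    nlinarith [sq_abs t]
  refine ⟨_, hsm, fun t => ⟨Real.smoothTransition.nonneg _, Real.smoothTransition.le_one _⟩,
    fun t ht => ?_, hzero, fun t => ?_⟩
  · refine Real.smoothTransition.one_of_one_le ((one_le_div hd).2 ?_)
    nlinarith [sq_abs t, abs_nonneg t]
  · have hbd : 0 ≤ 2 * L / (b - ρ) := div_nonneg (by linarith) (by linarith)
    rcases lt_or_ge b |t| with ht | ht
    · have h0 : (Real.smoothTransition ∘ q) =ᶠ[𝓝 t] fun _ => 0 := by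
        filter_upwards [continuous_abs.continuousAt.eventually_mem (Ioi_mem_nhds ht)] with u hu
        exact hzero u hu
      rw [h0.deriv_eq, deriv_const, abs_zero]
      exact hbd
    · have h1 : HasDerivAt q (-(2 * t) / (b ^ 2 - ρ ^ 2)) t := by
        have := ((hasDerivAt_pow 2 t).const_sub (b ^ 2)).div_const (b ^ 2 - ρ ^ 2)
        simpa using this
      have h2 := ((Real.smoothTransition.contDiff (n := 1)).differentiable one_ne_zero
        (q t)).hasDerivAt.comp t h1
      rw [h2.deriv, abs_mul, abs_div, abs_neg, abs_mul, abs_two, abs_of_pos hd]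
      have h3 : 2 * |t| / (b ^ 2 - ρ ^ 2) ≤ 2 / (b - ρ) := by
        rw [div_le_div_iff₀ hd (by linarith)]
        nlinarith [abs_nonneg t]
      calc |deriv Real.smoothTransition (q t)| * (2 * |t| / (b ^ 2 - ρ ^ 2))
          ≤ L * (2 / (b - ρ)) := mul_le_mul (hL _) h3 (by positivity) hL0
        _ = 2 * L / (b - ρ) := by ring

/-- The square has cut-off functions whose gradients are as small as the margin permits. -/
theorem exists_square_cutoff (c : Plane) (r : ℝ) : ∃ C : ℝ, ∀ ρ ∈ Ioo 0 r, ∃ φ : 𝓓(square c r, ℝ),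
    (∀ x ∈ square c ρ, φ x = 1) ∧ (∀ x, |φ x| ≤ 1) ∧
    ∀ x, ‖fderiv ℝ φ x‖ ≤ C / (r - ρ) := by
  obtain ⟨L, hL⟩ := exists_profile
  refine ⟨8 * L, fun ρ hρ => ?_⟩
  obtain ⟨s, hs, hs01, hs1, hs0, hsd⟩ := hL ρ ((r + ρ) / 2) hρ.1 (by linarith [hρ.2])
  have hsabs (t : ℝ) : |s t| ≤ 1 := abs_le.2 ⟨by linarith [(hs01 t).1], (hs01 t).2⟩
  set φ : Plane → ℝ := fun x => s (x 0 - c 0) * s (x 1 - c 1) with hφ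
  have hφs : ContDiff ℝ ∞ φ := by
    have h (i : Fin 2) : ContDiff ℝ ∞ fun x : Plane => s (x i - c i) := hs.comp (by fun_prop)
    exact (h 0).mul (h 1)
  set K : Set Plane := {x | ∀ i, |x i - c i| ≤ (r + ρ) / 2} with hK
  have hKc : IsClosed K := by
    simp only [hK, ofPred_forall]
    exact isClosed_iInter fun i => isClosed_le (by fun_prop) continuous_const
  have hKQ : K ⊆ square c r := fun x hx => mem_square.2 fun i => by linarith [hx i, hρ.2]
  have hsupp : Function.support φ ⊆ K := by
    intro x hx i
    by_contra hi
    rw [not_le] at hi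
    refine hx ?_
    fin_cases i
    · exact mul_eq_zero_of_left (hs0 _ hi) _
    · exact mul_eq_zero_of_right _ (hs0 _ hi)
  have htsupp : tsupport φ ⊆ K := closure_minimal hsupp hKc
  have hcomp : HasCompactSupport φ :=
    Metric.isCompact_of_isClosed_isBounded (isClosed_tsupport _)
      ((isBounded_square c r).subset (htsupp.trans hKQ))
  refine ⟨⟨φ, hφs, hcomp, htsupp.trans hKQ⟩, fun x hx => ?_, fun x => ?_, fun x => ?_⟩
  · change s (x 0 - c 0) * s (x 1 - c 1) = 1
    rw [hs1 _ (hx 0), hs1 _ (hx 1), one_mul]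
  · change |s (x 0 - c 0) * s (x 1 - c 1)| ≤ 1
    rw [abs_mul]
    exact mul_le_one₀ (hsabs _) (abs_nonneg _) (hsabs _)
  · change ‖fderiv ℝ φ x‖ ≤ _
    have hder (i : Fin 2) : HasFDerivAt (fun x : Plane => s (x i - c i))
        (deriv s (x i - c i) • (EuclideanSpace.proj i : Plane →L[ℝ] ℝ)) x := by
      have h1 : HasFDerivAt (fun x : Plane => x i - c i) (EuclideanSpace.proj i : Plane →L[ℝ] ℝ) x :=
        (EuclideanSpace.proj i : Plane →L[ℝ] ℝ).hasFDerivAt.sub_const _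
      exact (hs.differentiable (by simp) _).hasDerivAt.comp_hasFDerivAt x h1
    have hnorm (i j : Fin 2) : ‖s (x j - c j) • deriv s (x i - c i) •
        (EuclideanSpace.proj i : Plane →L[ℝ] ℝ)‖ ≤ 2 * L / ((r + ρ) / 2 - ρ) := by
      refine ContinuousLinearMap.opNorm_le_bound _ ((abs_nonneg _).trans (hsd 0)) fun v => ?_
      rw [smul_apply, smul_apply, smul_eq_mul, smul_eq_mul, norm_mul, norm_mul]
      exact (mul_le_of_le_one_left (by positivity) (hsabs _)).trans
        (mul_le_mul (hsd _) (PiLp.norm_apply_le v i) (norm_nonneg _)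
          ((abs_nonneg _).trans (hsd 0)))
    rw [show fderiv ℝ φ x = _ from ((hder 0).mul (hder 1)).fderiv]
    refine (norm_add_le _ _).trans ?_
    have e : 8 * L / (r - ρ) = 2 * L / ((r + ρ) / 2 - ρ) + 2 * L / ((r + ρ) / 2 - ρ) := by
      have : r - ρ ≠ 0 := by linarith [hρ.2]
      have h2 : (r + ρ) / 2 - ρ = (r - ρ) / 2 := by ring
      rw [h2]
      field_simp
      ring
    rw [e]
    exact add_le_add (hnorm 1 0) (hnorm 0 1)

/-! ### Comparison of the smoothed push-forward with the degree -/

theorem enorm_bracket_le (φ u : Plane → ℝ) (x : Plane) {M : ℝ} (hM : ‖fderiv ℝ φ x‖ ≤ M) :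
    ‖bracket φ u x‖ₑ ≤ ENNReal.ofReal M * (‖pderiv 0 u x‖ₑ + ‖pderiv 1 u x‖ₑ) := by
  have hM0 : 0 ≤ M := (norm_nonneg _).trans hM
  have hp (i : Fin 2) : |pderiv i φ x| ≤ M := by
    have := (fderiv ℝ φ x).le_opNorm (EuclideanSpace.single i 1)
    rw [PiLp.norm_single, norm_one, mul_one] at this
    exact this.trans hM
  rw [← ofReal_norm, ← ofReal_norm, ← ofReal_norm, ← ENNReal.ofReal_add (norm_nonneg _)
    (norm_nonneg _), ← ENNReal.ofReal_mul hM0]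
  refine ENNReal.ofReal_le_ofReal ?_
  simp only [Real.norm_eq_abs, bracket]
  refine (abs_sub _ _).trans ?_
  rw [abs_mul, abs_mul]
  nlinarith [mul_le_mul_of_nonneg_right (hp 0) (abs_nonneg (pderiv 1 u x)),
    mul_le_mul_of_nonneg_right (hp 1) (abs_nonneg (pderiv 0 u x))]

/-- Only the part of `Dg` near the set where the cut-off function is not constant contributes. -/
theorem lintegral_bracket_mollify_le {η : Plane → ℝ} (hη : IsMollifier η) {f g : Plane → Plane}
    (hf : Continuous f) {Ω : Opens Plane} (hfg : ∀ x ∈ Ω, f x = g x)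
    {Dg : VectorMeasure Plane PlaneMatrix} (hDg : IsDistribDeriv Ω g Dg) {φ : Plane → ℝ} {M : ℝ}
    (hM : ∀ x, ‖fderiv ℝ φ x‖ ≤ M) {U : Opens Plane} (hU : ∀ x ∈ U, φ x = 1) {ε : ℝ} (hε : 0 < ε)
    {B : Set Plane} (hB : MeasurableSet B) (hBΩ : B ⊆ Ω)
    (hAB : ∀ x ∈ tsupport φ, x ∉ U → Metric.closedBall x ε ⊆ B) (j : Fin 2) :
    ∫⁻ x, ‖bracket φ (fun x => mollify η ε ⊤ f x j) x‖ₑ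
      ≤ ENNReal.ofReal M * (2 * Dg.variation B) := by
  set A : Set Plane := tsupport φ \ U with hA
  have hAm : MeasurableSet A := (isClosed_tsupport _).measurableSet.diff U.isOpen.measurableSet
  set u : Plane → ℝ := fun x => mollify η ε ⊤ f x j with hu
  have hus : ContDiff ℝ ∞ u := contDiff_coord (contDiff_mollify hη hf hε) j
  have hpt (x : Plane) : ‖bracket φ u x‖ₑ
      ≤ A.indicator (fun x => ENNReal.ofReal M * (‖pderiv 0 u x‖ₑ + ‖pderiv 1 u x‖ₑ)) x := by
    by_cases hx : x ∈ A
    · rw [indicator_of_mem hx]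
      exact enorm_bracket_le φ u x (hM x)
    · have h0 : fderiv ℝ φ x = 0 := by
        by_cases hxU : x ∈ U
        · have : (φ : Plane → ℝ) =ᶠ[𝓝 x] fun _ => 1 := by
            filter_upwards [U.isOpen.mem_nhds hxU] with z hz using hU z hz
          rw [this.fderiv_eq, fderiv_const_apply]
        · have hxs : x ∉ tsupport φ := fun h => hx ⟨h, hxU⟩
          have : x ∉ tsupport (fderiv ℝ φ) := fun h => hxs (tsupport_fderiv_subset ℝ h)
          exact image_eq_zero_of_notMem_tsupport this
      simp [bracket, pderiv, h0]
  refine (lintegral_mono hpt).trans ?_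
  rw [lintegral_indicator hAm, lintegral_const_mul' _ _ ENNReal.ofReal_ne_top,
    lintegral_add_left (hus.continuous_pderiv (by simp) 0).measurable.enorm, two_mul]
  have hle (i : Fin 2) := lintegral_pderiv_mollify_le hη hf hfg hDg hε hAm hB hBΩ
    (fun x hx => hAB x hx.1 hx.2) i j
  exact mul_le_mul' le_rfl (add_le_add (hle 0) (hle 1))

theorem pushforwardDensity_eq_topDegree {η : Plane → ℝ} (hη : IsMollifier η) {δ s : ℝ}
    (hδ : 0 < δ) {Ω U : Opens Plane} (hUΩ : U ≤ Ω) (hb : Bornology.IsBounded (Ω : Set Plane))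
    (φ : 𝓓(Ω, ℝ)) (hU : ∀ x ∈ U, φ x = 1) {f h : Plane → Plane} (hh : ContDiff ℝ ∞ h)
    {y : Plane} (hclose : ∀ x ∈ closure (Ω : Set Plane), dist (h x) (f x) ≤ s)
    (hfar : ∀ x ∈ closure (Ω : Set Plane), x ∉ U → s + δ < dist (f x) y) :
    pushforwardDensity η δ φ h y = topDegree f (Ω : Set Plane) y := by
  rw [← kernelDegree_eq_topDegree hη Ω.isOpen hb hh hδ hclose fun z hz =>
    hfar z (frontier_subset_closure hz) fun hzU => ?_]
  · rw [pushforwardDensity, kernelDegree, ← setIntegral_eq_integral_of_forall_compl_eq_zero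
      (s := (Ω : Set Plane)) fun x hx => ?_]
    · refine setIntegral_congr_fun Ω.isOpen.measurableSet fun x hx => ?_
      by_cases hxU : x ∈ U
      · simp [hU x hxU]
      · have h1 := hfar x (subset_closure hx) hxU
        have h2 := hclose x (subset_closure hx)
        have h3 := dist_triangle (f x) (h x) y
        rw [dist_comm (f x) (h x)] at h3
        have h4 : δ < ‖h x - y‖ := by
          rw [← dist_eq_norm]
          linarith
        simp [hη.kernel_eq_zero hδ h4]
    · have : φ x = 0 := image_eq_zero_of_notMem_tsupport fun h => hx (φ.tsupport_subset h)
      rw [this, zero_mul]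
  · have := disjoint_left.1 (disjoint_frontier_iff_isOpen.2 Ω.isOpen) hz
    exact this (hUΩ hzU)

/-! ### The total mass of the distributional Jacobian -/

/-- The degree is the limit of the smoothed push-forwards of `φₖ det ∇gₑ`, which are bounded in
`L²` by the condition on `|Dg|` near the boundary. -/
theorem integrable_topDegree_and_tendsto {c : Plane} {r : ℝ} {f g : Plane → Plane}
    (hf : Continuous f) (hfc : HasCompactSupport f)
    (hfg : ∀ x ∈ closure (square c r : Set Plane), f x = g x)
    {Dg : VectorMeasure Plane PlaneMatrix} (hDg : IsDistribDeriv (square c r) g Dg)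
    (hnull : volume (g '' frontier (square c r : Set Plane)) = 0) {S : ENNReal} (hS : S ≠ ⊤)
    (hvar : ∀ ρ ∈ Ioo 0 r, Dg.variation ((square c r : Set Plane) \ (square c ρ : Set Plane))
      ≤ S * ENNReal.ofReal (r - ρ))
    {η : Plane → ℝ} (hη : IsMollifier η) {J : 𝓓(square c r, ℝ) → ℝ}
    (hJ : ∀ φ : 𝓓(square c r, ℝ),
      Tendsto (fun ε => ∫ x, φ x * (fderiv ℝ (mollify η ε ⊤ f) x).det) (𝓝[>] 0) (𝓝 (J φ)))
    {C : ℝ} {ρ : ℕ → ℝ} {φ : ℕ → 𝓓(square c r, ℝ)} (hρ : ∀ k, ρ k ∈ Ioo 0 r)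
    (hρr : Tendsto ρ atTop (𝓝 r)) (hφ1 : ∀ k, ∀ x ∈ square c (ρ k), φ k x = 1)
    (hφC : ∀ k x, ‖fderiv ℝ (φ k) x‖ ≤ C / (r - ρ k)) :
    Integrable (fun y => (topDegree g (square c r : Set Plane) y : ℝ)) ∧
      Tendsto (fun k => J (φ k)) atTop
        (𝓝 (∫ y, (topDegree g (square c r : Set Plane) y : ℝ))) := by
  have hfg' : ∀ x ∈ square c r, f x = g x := fun x hx => hfg x (subset_closure hx)
  have hfu : UniformContinuous f := hfc.uniformContinuous_of_continuous hf
  obtain ⟨R, hR⟩ := hf.bounded_above_of_compact_support hfc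
  have hb := isBounded_square c r
  have hsub (t : ℝ) (ht : t ≤ r) : square c t ≤ square c r := fun x hx i => (hx i).trans_le ht
  -- a common rate for the choice of the parameters
  set τ : ℕ → ℝ := fun k => 1 / ((k : ℝ) + 1) with hτ
  have hτ0 (k) : 0 < τ k := by positivity
  have hτ1 (k) : τ k ≤ 1 := by
    rw [hτ, div_le_one (by positivity)]
    linarith [Nat.cast_nonneg (α := ℝ) k]
  have hτlim : Tendsto τ atTop (𝓝 0) := tendsto_one_div_add_atTop_nhds_zero_nat
  have hex (k) : ∃ ε, 0 < ε ∧ ε ≤ r - ρ k ∧ ε < ρ k ∧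
      (∀ x ∈ tsupport (φ k), Metric.closedBall x ε ⊆ square c r) ∧
      (∀ x, dist (mollify η ε ⊤ f x) (f x) ≤ τ k) ∧
      dist (∫ x, φ k x * (fderiv ℝ (mollify η ε ⊤ f) x).det) (J (φ k)) < τ k := by
    obtain ⟨δ, hδ, hball⟩ := TestFunction.exists_closedBall_subset (φ k)
    have h1 : ∀ᶠ ε in 𝓝[>] (0 : ℝ), ε ∈ Ioo 0 (min δ (min (r - ρ k) (ρ k))) :=
      Ioo_mem_nhdsGT (lt_min hδ (lt_min (sub_pos.2 (hρ k).2) (hρ k).1))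
    obtain ⟨ε, h1, h2, h3⟩ := (h1.and ((eventually_dist_mollify_le hη hf hfu (hτ0 k)).and
      ((hJ (φ k)).eventually (Metric.ball_mem_nhds _ (hτ0 k))))).exists
    have h4 := h1.2
    rw [lt_min_iff, lt_min_iff] at h4
    exact ⟨ε, h1.1, h4.2.1.le, h4.2.2, fun x hx =>
      (Metric.closedBall_subset_closedBall h4.1.le).trans (hball x hx), h2, h3⟩
  choose ε hε0 hεr hερ hεball hclose hJε using hex
  set h : ℕ → Plane → Plane := fun k => mollify η (ε k) ⊤ f with hh
  have hhs (k) : ContDiff ℝ ∞ (h k) := contDiff_mollify hη hf (hε0 k)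
  set u : ℕ → Plane → ℝ := fun k => pushforwardDensity η (τ k) (φ k) (h k) with hu
  have hus (k) : ContDiff ℝ 1 (u k) := contDiff_pushforwardDensity hη (hτ0 k) (φ k).contDiff
    (φ k).hasCompactSupport (hhs k)
  -- the bound in `L²`
  have hbr (k) (j : Fin 2) : ∫⁻ x, ‖bracket (φ k) (fun x => h k x j) x‖ₑ
      ≤ 4 * S * ENNReal.ofReal C := by
    have hρk := hρ k
    have hm := hεr k
    refine (lintegral_bracket_mollify_le hη hf hfg' hDg (hφC k) (hφ1 k) (hε0 k)
      ((measurableSet_square c r).diff (measurableSet_square c (ρ k - ε k))) sdiff_subset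
      (fun x hx hxU z hz => ⟨hεball k x hx hz, closedBall_subset_compl_square hxU hz⟩) j).trans ?_
    -- `ε k ≤ r - ρ k`, so that the mollification at most doubles the width of the frame
    have h1 := hvar (ρ k - ε k) ⟨sub_pos.2 (hερ k), by linarith [hρk.2, hε0 k]⟩
    have h2 : ENNReal.ofReal (r - (ρ k - ε k)) ≤ ENNReal.ofReal (2 * (r - ρ k)) :=
      ENNReal.ofReal_le_ofReal (by linarith)
    have h3 : ENNReal.ofReal (C / (r - ρ k)) * ENNReal.ofReal (2 * (r - ρ k))
        = 2 * ENNReal.ofReal C := by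
      have h0 : 0 < r - ρ k := sub_pos.2 hρk.2
      rw [← ENNReal.ofReal_mul' (by linarith), ← ENNReal.ofReal_ofNat,
        ← ENNReal.ofReal_mul (by norm_num)]
      congr 1
      field_simp
    calc ENNReal.ofReal (C / (r - ρ k)) * (2 * Dg.variation (square c r \ square c (ρ k - ε k)))
        ≤ ENNReal.ofReal (C / (r - ρ k)) * (2 * (S * ENNReal.ofReal (2 * (r - ρ k)))) :=
          mul_le_mul' le_rfl (mul_le_mul' le_rfl (h1.trans (mul_le_mul' le_rfl h2)))
      _ = 2 * S * (ENNReal.ofReal (C / (r - ρ k)) * ENNReal.ofReal (2 * (r - ρ k))) := by ring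
      _ = 4 * S * ENNReal.ofReal C := by rw [h3]; ring
  set K : ENNReal := eLpNormLESNormFDerivOneConst (volume : Measure Plane) (2 : NNReal) *
    (4 * S * ENNReal.ofReal C + 4 * S * ENNReal.ofReal C) with hK
  have hKtop : K ≠ ⊤ := by
    have : 4 * S * ENNReal.ofReal C ≠ ⊤ :=
      ENNReal.mul_ne_top (ENNReal.mul_ne_top (by norm_num) hS) ENNReal.ofReal_ne_top
    exact ENNReal.mul_ne_top ENNReal.coe_ne_top (ENNReal.add_ne_top.2 ⟨this, this⟩)
  have huK (k) : eLpNorm (u k) 2 volume ≤ K :=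
    (eLpNorm_pushforwardDensity_le hη (hτ0 k) (φ k).contDiff (φ k).hasCompactSupport (hhs k)).trans
      (mul_le_mul' le_rfl (add_le_add (hbr k 1) (hbr k 0)))
  have huB (k) : ∀ y ∉ Metric.closedBall (0 : Plane) (R + 2), u k y = 0 := by
    intro y hy
    rw [mem_closedBall_zero_iff, not_le] at hy
    refine pushforwardDensity_eq_zero hη (hτ0 k) (R := R + 1) (fun x _ => ?_)
      (by linarith [hτ1 k])
    have h1 := hclose k x
    rw [dist_eq_norm] at h1
    have h2 := norm_le_norm_add_norm_sub' (h k x) (f x)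
    linarith [hR x, hτ1 k]
  -- off the image of the boundary, the push-forwards are eventually equal to the degree
  have hlim : ∀ᵐ y, Tendsto (fun k => u k y) atTop
      (𝓝 (topDegree g (square c r : Set Plane) y : ℝ)) := by
    have hae : ∀ᵐ y, y ∉ g '' frontier (square c r : Set Plane) :=
      measure_eq_zero_iff_ae_notMem.1 hnull
    filter_upwards [hae] with y hy
    have hfrc : IsCompact (frontier (square c r : Set Plane)) :=
      hb.isCompact_closure.of_isClosed_subset isClosed_frontier frontier_subset_closure
    obtain ⟨m, hm, hmin⟩ := hfrc.exists_forall_le' (f := fun z => dist (f z) y) (a := 0)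
      (by fun_prop) fun z hz => dist_pos.2 fun hzy =>
        hy ⟨z, hz, by rw [← hfg z (frontier_subset_closure hz), hzy]⟩
    -- the points of the closed square that are mapped close to `y` lie in a smaller square
    have hKc : IsCompact (closure (square c r : Set Plane) ∩ {x | dist (f x) y ≤ m / 2}) :=
      hb.isCompact_closure.inter_right (isClosed_le (by fun_prop) continuous_const)
    obtain ⟨s, hs, hKs⟩ := hKc.exists_subset_square (c := c) (r := r) fun x hx => by
      by_contra hxQ
      have hx2 : dist (f x) y ≤ m / 2 := hx.2
      have := hmin x (by rw [(square c r).isOpen.frontier_eq]; exact ⟨hx.1, hxQ⟩)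
      linarith
    refine tendsto_const_nhds.congr' ?_
    filter_upwards [hρr.eventually (lt_mem_nhds hs),
      hτlim.eventually (gt_mem_nhds (show 0 < m / 4 by linarith))] with k hk1 hk2
    refine (pushforwardDensity_eq_topDegree hη (hτ0 k) (hsub _ (hρ k).2.le) hb (φ k) (hφ1 k) (hhs k)
      (s := τ k) (fun x hx => ?_) fun x hx hxU => ?_).symm
    · rw [← hfg x hx]
      exact hclose k x
    · rw [← hfg x hx]
      by_contra hlt
      exact hxU (hKs _ hk1 ⟨hx, by simp only [mem_ofPred_eq]; linarith⟩)
  obtain ⟨hint, hconv⟩ := integrable_and_tendsto_integral_of_eLpNorm_two_le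
    (fun k => (hus k).continuous.aestronglyMeasurable) hKtop huK
    Metric.isClosed_closedBall.measurableSet measure_closedBall_lt_top.ne huB hlim
  refine ⟨hint, hconv.congr_dist (squeeze_zero (fun _ => dist_nonneg) (fun k => ?_) hτlim)⟩
  rw [hu]
  simp only []
  rw [integral_pushforwardDensity hη (hτ0 k) (φ k).contDiff (φ k).hasCompactSupport (hhs k)]
  exact (hJε k).le

/-- A signed measure on the square is the limit of its values on bounded cut-off functions. -/
theorem tendsto_vectorIntegral_cutoff {c : Plane} {r : ℝ} (μ : SignedMeasure Plane) {ρ : ℕ → ℝ}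
    (hρr : Tendsto ρ atTop (𝓝 r)) {φ : ℕ → Plane → ℝ} (hφ : ∀ k, Continuous (φ k))
    (hφ1 : ∀ k, ∀ x ∈ square c (ρ k), φ k x = 1) (hφb : ∀ k x, |φ k x| ≤ 1) :
    Tendsto (fun k => ∫ᵛ x in (square c r : Set Plane), φ k x ∂•μ) atTop
      (𝓝 (μ (square c r : Set Plane))) := by
  have hQ := measurableSet_square c r
  have hfin : IsFiniteMeasure (μ.restrict (square c r : Set Plane)).variation := by
    rw [VectorMeasure.variation_restrict hQ, ← SignedMeasure.totalVariation_eq_variation]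
    infer_instance
  have h1 : μ (square c r : Set Plane)
      = ∫ᵛ x in (square c r : Set Plane), (1 : ℝ) ∂•μ := by
    rw [VectorMeasure.integral_const, VectorMeasure.restrict_apply _ hQ MeasurableSet.univ]
    simp
  rw [h1]
  refine VectorMeasure.tendsto_integral_filter_of_norm_le_const
    (Eventually.of_forall fun k => (hφ k).aestronglyMeasurable)
    ⟨1, Eventually.of_forall fun k => Eventually.of_forall (hφb k)⟩ ?_
  rw [VectorMeasure.variation_restrict hQ]
  filter_upwards [ae_restrict_mem hQ] with x hx
  obtain ⟨s, hs, hxs⟩ := (isCompact_singleton (x := x)).exists_subset_square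
    (singleton_subset_iff.2 hx)
  refine tendsto_const_nhds.congr' ?_
  filter_upwards [hρr.eventually (lt_mem_nhds hs)] with k hk
  exact (hφ1 k x (singleton_subset_iff.1 (hxs _ hk))).symm

/-- Only the values on the closed square matter, so `g` may be extended by Tietze's theorem. -/
theorem exists_continuous_extension {c : Plane} {r : ℝ} {g : Plane → Plane}
    (hg : ContinuousOn g (closure (square c r : Set Plane))) :
    ∃ f : Plane → Plane, Continuous f ∧ HasCompactSupport f ∧
      ∀ x ∈ closure (square c r : Set Plane), f x = g x := by
  obtain ⟨F, hF⟩ := ContinuousMap.exists_restrict_eq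
    (isClosed_closure (s := (square c r : Set Plane))) ⟨_, hg.domRestrict⟩
  obtain ⟨χ, hχ, hχc, -, hχ1, -⟩ := exists_cutoff (isBounded_square c r).isCompact_closure
    isOpen_univ (subset_univ _)
  refine ⟨fun x => χ x • F x, hχ.continuous.smul F.continuous, hχc.smul_right, fun x hx => ?_⟩
  have h1 := DFunLike.congr_fun hF ⟨x, hx⟩
  have h2 : χ x = 1 := (hχ1 x hx).self_of_nhds
  simp only [ContinuousMap.restrict_apply, ContinuousMap.coe_mk, domRestrict_apply] at h1
  simp [h2, h1]

theorem theorem3p5 (c : Plane) (r : ℝ) (hr : 0 < r) (g : Plane → Plane)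
    (Dg : VectorMeasure Plane PlaneMatrix)
    (hBV : IsBVWith (square c r) g Dg)
    (hcont : ContinuousOn g (closure (square c r : Set Plane)))
    (hnull : volume (g '' frontier (square c r : Set Plane)) = 0)
    (hsup : ⨆ ρ ∈ Ioo 0 r,
      Dg.variation ((square c r : Set Plane) \ (square c ρ : Set Plane)) / ENNReal.ofReal (r - ρ)
        < ⊤) :
    Integrable (fun y => (topDegree g (square c r : Set Plane) y : ℝ)) ∧
    ∃ J : 𝓓'(square c r, ℝ), IsDistribJacobian (square c r) g J ∧
      (∀ μ : SignedMeasure Plane, IsRepresentedBy (square c r) J μ →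
        ∫ y, (topDegree g (square c r : Set Plane) y : ℝ) = μ (square c r : Set Plane)) ∧
      HasCutoffMass c r J (∫ y, (topDegree g (square c r : Set Plane) y : ℝ)) := by
  obtain ⟨f, hf, hfc, hfg⟩ := exists_continuous_extension hcont
  have hfg' : ∀ x ∈ square c r, f x = g x := fun x hx => hfg x (subset_closure hx)
  have hfu : UniformContinuous f := hfc.uniformContinuous_of_continuous hf
  have hDg := hBV.isDistribDeriv
  obtain ⟨R, hR⟩ := hf.bounded_above_of_compact_support hfc
  let v : BoundedContinuousFunction Plane ℝ :=
    BoundedContinuousFunction.ofNormedAddCommGroup (fun x => f x 0) (by fun_prop) R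
      fun x => (PiLp.norm_apply_le (f x) 0).trans (hR x)
  have hv : ∀ x, v x = f x 0 := fun _ => rfl
  set J := jacobianDistribution (square c r) Dg v with hJ
  have hvar : ∀ ρ ∈ Ioo 0 r, Dg.variation ((square c r : Set Plane) \ (square c ρ : Set Plane))
      ≤ (⨆ ρ ∈ Ioo 0 r, Dg.variation ((square c r : Set Plane) \ (square c ρ : Set Plane))
        / ENNReal.ofReal (r - ρ)) * ENNReal.ofReal (r - ρ) := by
    intro ρ hρ
    have h0 : ENNReal.ofReal (r - ρ) ≠ 0 := by simpa using hρ.2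
    rw [← ENNReal.div_le_iff h0 ENNReal.ofReal_ne_top]
    exact le_iSup₂ (f := fun ρ (_ : ρ ∈ Ioo 0 r) => Dg.variation
      ((square c r : Set Plane) \ (square c ρ : Set Plane)) / ENNReal.ofReal (r - ρ)) ρ hρ
  obtain ⟨η, hη⟩ := exists_isMollifier
  have key {C : ℝ} {ρ : ℕ → ℝ} {φ : ℕ → 𝓓(square c r, ℝ)} (hρ : ∀ k, ρ k ∈ Ioo 0 r)
      (hρr : Tendsto ρ atTop (𝓝 r)) (hφ1 : ∀ k, ∀ x ∈ square c (ρ k), φ k x = 1)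
      (hφC : ∀ k x, ‖fderiv ℝ (φ k) x‖ ≤ C / (r - ρ k)) :=
    integrable_topDegree_and_tendsto hf hfc hfg hDg hnull hsup.ne hvar hη (J := J)
      (isDistribJacobian_tendsto hη hf hfu hfg' hDg v hv) hρ hρr hφ1 hφC
  -- an admissible sequence of cut-off functions
  obtain ⟨C, hC⟩ := exists_square_cutoff c r
  have hexρ : ∃ ρ : ℕ → ℝ, (∀ k, ρ k ∈ Ioo 0 r) ∧ Tendsto ρ atTop (𝓝 r) := by
    obtain ⟨ρ, -, h1, h2⟩ := exists_seq_strictMono_tendsto' hr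
    exact ⟨ρ, h1, h2⟩
  obtain ⟨ρ, hρ, hρr⟩ := hexρ
  choose φ hφ1 hφb hφC using fun k => hC (ρ k) (hρ k)
  obtain ⟨hint, hlim⟩ := key hρ hρr hφ1 hφC
  refine ⟨hint, J, isDistribJacobian_jacobianDistribution hf hfu hfg' hDg v hv, fun μ hμ => ?_,
    fun C' ρ' φ' hρ' hρr' hφ1' hφC' => (key hρ' hρr' hφ1' hφC').2⟩
  refine tendsto_nhds_unique (hlim.congr fun k => hμ (φ k)) ?_
  exact tendsto_vectorIntegral_cutoff μ hρr (fun k => (φ k).contDiff.continuous) hφ1 hφb
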